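/- For $p\in\mathbb N=\{1,2,\dots\}$ and $n\ge 0$ put $\zeta_n(p;x)=\sum_{k=1}^n x^k/k^p$ and $\mathrm{Li}_p(x)=\lim_{n\to\infty}\zeta_n(p;x)$ (for $|x|\le 1$, $(p,x)\ne(1,1)$). For a root of unity $x\neq 1$ let $\phi(s;x)=\sum_{k=0}^\infty \frac{x^k}{k+s}$, and let $\phi(s;1)=\sum_{k=0}^\infty\big(\frac1{k+s}-\frac1{k+1}\big)$ $(s\notin\{0,-1,-2,\dots\})$. Let $\Phi(s;x)=\phi(s;x)-\phi(-s;x^{-1})-\frac1s$ and let $\phi^{(j)}(s;x)$ be the $j$-th derivative in $s$. Write $c_k(x)=(-1)^k\mathrm{Li}_{k+1}(x)-\mathrm{Li}_{k+1}(x^{-1})$, with $c_0(1)=0$. **Theorem.** Let $x,y$ be roots of unity and $p\ge 1$ with $(p,y)\ne(1,1)$. Let $r_1$ be a complex rational function with set of poles $S_1$, having no pole at any nonzero integer and a pole of order $q\ge 0$ at $0$ ($q=0$: no pole), and put $R_1(s)=s^q r_1(s)$. Assume that, as $|s|\to\infty$, either $r_1(s)=O(s^{-2})$, or $r_1(s)=O(s^{-1})$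 and $xy\neq 1$. Then the four infinite series below converge (as limits of their partial sums) and \begin{align*} &-\sum_{\alpha\in S_1\setminus\{0\}}\mathrm{Res}\left(\frac{\Phi(s;x)\,\phi^{(p-1)}(s;y)}{(p-1)!}(-1)^{p-1}r_1(s),\ s=\alpha\right)\\ &=\sum_{n=1}^\infty (xy)^{-n}\big(\mathrm{Li}_p(y)-\zeta_{n-1}(p;y)\big)r_1(n)+\sum_{n=1}^\infty (xy)^n\frac{r_1^{(p)}(-n)}{p!}\\ &\quad+\sum_{n=1}^\infty\sum_{k=0}^{p-1}c_k(x)\,\frac{(xy)^n r_1^{(p-k-1)}(-n)}{(p-k-1)!}+\sum_{n=1}^\infty\big(\mathrm{Li}_p(y)+(-1)^p\zeta_n(p;y^{-1})\big)(xy)^n r_1(-n)\\ &\quad+\frac{R_1^{(p+q)}(0)}{(p+q)!}+\sum_{k=0}^{q}\binom{k+p-1}{p-1}(-1)^k\mathrm{Li}_{k+p}(y)\frac{R_1^{(q-k)}(0)}{(q-k)!}+\sum_{k=0}^{p+q-1}c_k(x)\frac{R_1^{(p+q-k-1)}(0)}{(p+q-k-1)!}\\ &\quad+\sum_{\substack{k_1,k_2\ge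 0\\ k_1+k_2\le q-1}}c_{k_1}(x)\binom{k_2+p-1}{p-1}(-1)^{k_2}\mathrm{Li}_{k_2+p}(y)\frac{R_1^{(q-k_1-k_2-1)}(0)}{(q-k_1-k_2-1)!}. \end{align*} -/

import Mathlib

open Filter Topology Asymptotics

noncomputable section

namespace CyclotomicEuler

/-- The finite polylogarithm sum `ζ_n(p; x) = ∑_{k=1}^n x^k / k^p`. -/
def zetaFin (n p : ℕ) (x : ℂ) : ℂ := ∑ k ∈ Finset.Icc 1 n, x ^ k / (k : ℂ) ^ p

/-- The polylogarithm `Li_p(x) = lim_{n → ∞} ζ_n(p; x)`, for `|x| ≤ 1` and `(p, x) ≠ (1, 1)`.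
For `(p, x) = (1, 1)` the limit does not exist and the value is meaningless. -/
def polylog (p : ℕ) (x : ℂ) : ℂ := limUnder atTop fun n : ℕ => zetaFin n p x

/-- The generalized digamma function. For `x ≠ 1` it is `φ(s; x) = ∑_{k=0}^∞ x^k / (k + s)`, as the
limit of the partial sums (the series converges only conditionally when `|x| = 1`). For `x = 1`,
where that series diverges, it is the regularized sum `∑_{k=0}^∞ (1/(k+s) - 1/(k+1)) = -ψ(s) - γ`,
whose derivatives are the termwise ones. -/
def genDigamma (s x : ℂ) : ℂ :=
  limUnder atTop fun N : ℕ =>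
    ∑ k ∈ Finset.range N, (x ^ k / ((k : ℂ) + s) - if x = 1 then 1 / ((k : ℂ) + 1) else 0)

/-- The extended trigonometric function `Φ(s; x) = φ(s; x) - φ(-s; x⁻¹) - 1/s`.
(For `x = 1` it is `π cot(π s)`.) -/
def extTrig (s x : ℂ) : ℂ := genDigamma s x - genDigamma (-s) x⁻¹ - 1 / s

/-- The residue of `f` at `α`: the value of `(2πi)⁻¹ ∮_{|s - α| = ε} f(s) ds` for small `ε > 0`. -/
def residue (f : ℂ → ℂ) (α : ℂ) : ℂ :=
  limUnder (𝓝[>] (0 : ℝ)) fun ε : ℝ =>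
    (2 * (Real.pi : ℂ) * Complex.I)⁻¹ * ∮ s in C(α, ε), f s

/-- The value of a rational function at a point (meaningful where it has no pole). -/
def ratVal (r : RatFunc ℂ) (s : ℂ) : ℂ := r.eval (RingHom.id ℂ) s

/-- The finite set of poles of a rational function: the zeros of the reduced denominator. -/
def poles (r : RatFunc ℂ) : Finset ℂ := r.denom.roots.toFinset

/-- `Φ(s; x) φ^{(p-1)}(s; y) / (p-1)! · (-1)^{p-1} · r(s)`, derivatives being in `s`. -/
def integrand (p : ℕ) (x y : ℂ) (r : RatFunc ℂ) (s : ℂ) : ℂ :=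
  extTrig s x * iteratedDeriv (p - 1) (fun z => genDigamma z y) s / ((p - 1).factorial : ℂ)
    * (-1) ^ (p - 1) * ratVal r s

/-- The coefficient `(-1)^k Li_{k+1}(x) - Li_{k+1}(x⁻¹)`.
For `x = 1` and `k = 0` the two terms cancel, so the value is `0`. -/
def trigCoeff (k : ℕ) (x : ℂ) : ℂ := (-1) ^ k * polylog (k + 1) x - polylog (k + 1) x⁻¹

/-- The normalized derivative `f^{(j)}(a) / j!`. -/
def taylorCoeff (f : ℂ → ℂ) (j : ℕ) (a : ℂ) : ℂ := iteratedDeriv j f a / (j.factorial : ℂ)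

/-- The series `∑_{n=1}^∞ u n` converges (as the limit of its partial sums) to `S`. -/
def SeriesTo (u : ℕ → ℂ) (S : ℂ) : Prop :=
  Tendsto (fun N : ℕ => ∑ n ∈ Finset.Icc 1 N, u n) atTop (𝓝 S)

theorem trigCoeff_zero_one : trigCoeff 0 1 = 0 := by simp [trigCoeff]

end CyclotomicEuler

end

/-! The classical proof integrates `Φ(s; x) φ^{(p-1)}(s; y) r₁(s)` over growing circles: the sum of
all residues is zero. Here no estimate of the kernel on large contours is needed, because the two
series are cut off before any residue is taken. `Φ` is replaced by the symmetric sum over `|m| ≤ N`,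
and the normalized derivative of `φ` by the sum over `0 ≤ m ≤ M`. The integrand becomes a rational
function. Both sums tend to `0` at infinity and `s r₁(s)` stays bounded, so the product is `o(s⁻¹)`
and its residues add up to zero (`sum_residue_eq_zero`, by Liouville; `sum_residue_truncated`).

At `-n` with `0 ≤ n ≤ M` the residue is a coefficient of a product of three power series, and
expanding it gives the four groups of terms in `localResidue`. Beyond these there are the simple
poles at positive integers, those at `-n` with `M < n ≤ N`, and the non-integral poles of `r₁`.

The limit `N → ∞` is taken first, then `M → ∞`. Symmetry of the first cut-off produces `c_k(x)`,
including `c_0(1) = 0` where the separate series diverge. At non-integral poles, locally uniform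
convergence of the kernels gives convergence of the residues. Two errors must disappear as `M → ∞`:
the simple poles beyond `-M` (`tendsto_tsum_negative`, dominated convergence) and the replacement of
`ζ_{M-n}(p; y)` by `Li_p(y)` (`tendsto_sum_tail_mul`, a convolution of size `log M / M`). Both rest
on the tail bound `Li_p(y) - ζ_n(p; y) = O(n⁻¹)`, valid since `(p, y) ≠ (1, 1)`. The alternative `xy
≠ 1` serves only for convergence of series on the negative side, through summation by parts. -/

noncomputable section

namespace CyclotomicEuler

/-! ### Taylor coefficients -/

/-- The Taylor series of `f` at `a`, as a formal power series. -/
def taylorSeries (f : ℂ → ℂ) (a : ℂ) : PowerSeries ℂ := PowerSeries.mk fun j => taylorCoeff f j a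

@[simp]
theorem coeff_taylorSeries (f : ℂ → ℂ) (a : ℂ) (j : ℕ) :
    PowerSeries.coeff j (taylorSeries f a) = taylorCoeff f j a := by
  simp [taylorSeries]

theorem taylorCoeff_mul {f g : ℂ → ℂ} {a : ℂ} (hf : AnalyticAt ℂ f a) (hg : AnalyticAt ℂ g a)
    (n : ℕ) : taylorCoeff (fun s => f s * g s) n a =
      ∑ i ∈ Finset.range (n + 1), taylorCoeff f i a * taylorCoeff g (n - i) a := by
  rw [taylorCoeff, iteratedDeriv_fun_mul hf.contDiffAt hg.contDiffAt, Finset.sum_div]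
  refine Finset.sum_congr rfl fun i hi => ?_
  have hi' : i ≤ n := Nat.lt_succ_iff.mp (Finset.mem_range.mp hi)
  have h : (n.choose i : ℂ) * i.factorial * (n - i).factorial = n.factorial := by
    exact_mod_cast Nat.choose_mul_factorial_mul_factorial hi'
  have h1 : (n.factorial : ℂ) ≠ 0 := by exact_mod_cast n.factorial_ne_zero
  have h2 : (i.factorial : ℂ) ≠ 0 := by exact_mod_cast i.factorial_ne_zero
  have h3 : ((n - i).factorial : ℂ) ≠ 0 := by exact_mod_cast (n - i).factorial_ne_zero
  simp only [taylorCoeff]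
  rw [← h] at h1 ⊢
  have h4 := left_ne_zero_of_mul (left_ne_zero_of_mul h1)
  field_simp

theorem taylorSeries_mul {f g : ℂ → ℂ} {a : ℂ} (hf : AnalyticAt ℂ f a) (hg : AnalyticAt ℂ g a) :
    taylorSeries (fun s => f s * g s) a = taylorSeries f a * taylorSeries g a := by
  ext n
  rw [coeff_taylorSeries, taylorCoeff_mul hf hg, PowerSeries.coeff_mul,
    Finset.Nat.sum_antidiagonal_eq_sum_range_succ_mk]
  simp

/-! ### Residues -/

/-- `f` has at most a pole at `α`, and `c` is the coefficient of `(s - α)⁻¹` in its Laurent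
expansion. -/
def HasResidue (f : ℂ → ℂ) (α c : ℂ) : Prop :=
  ∃ (h : ℂ → ℂ) (m : ℕ), AnalyticAt ℂ h α ∧ (∀ᶠ s in 𝓝[≠] α, f s = h s / (s - α) ^ (m + 1)) ∧
    c = taylorCoeff h m α

/-- Cauchy's formula for the `m`-th derivative applies on every sufficiently small circle, so the
function whose limit defines `residue` is eventually constant. -/
theorem HasResidue.residue_eq {f : ℂ → ℂ} {α c : ℂ} (hf : HasResidue f α c) :
    residue f α = c := by
  obtain ⟨h, m, hh, hfh, rfl⟩ := hf
  refine Tendsto.limUnder_eq (tendsto_const_nhds.congr' ?_)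
  rw [eventually_nhdsWithin_iff, Metric.eventually_nhds_iff] at hfh
  obtain ⟨δ, hδ, hfh⟩ := hfh
  obtain ⟨δ', hδ', hd⟩ := Metric.eventually_nhds_iff.mp hh.eventually_analyticAt
  filter_upwards [Ioo_mem_nhdsGT (lt_min hδ hδ')] with ε hε
  have hε' := lt_min_iff.mp hε.2
  have hint : (∮ s in C(α, ε), f s) = ∮ s in C(α, ε), (1 / (s - α) ^ (m + 1)) • h s := by
    refine circleIntegral.integral_congr hε.1.le fun s hs => ?_
    have hs' : dist s α = ε := hs
    rw [hfh (by rw [hs']; exact hε'.1)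
      (fun h0 => hε.1.ne' (by rw [← hs', Set.mem_singleton_iff.mp h0, dist_self]))]
    simp [div_eq_inv_mul]
  have hdiff : DifferentiableOn ℂ h (Metric.closedBall α ε) := fun s hs =>
    (hd (lt_of_le_of_lt hs hε'.2)).differentiableAt.differentiableWithinAt
  rw [hint, hdiff.circleIntegral_one_div_sub_center_pow_smul hε.1, taylorCoeff, smul_eq_mul]
  have := Complex.two_pi_I_ne_zero
  field_simp

/-- Expanding the numerator `h` to order `m` and dividing by `(s - α)^(m+1)` gives the principal
part; the Taylor remainder supplies the analytic part `k`. -/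
theorem HasResidue.exists_principal {f : ℂ → ℂ} {α c : ℂ} (hf : HasResidue f α c) :
    ∃ (a : ℕ → ℂ) (m : ℕ) (k : ℂ → ℂ), AnalyticAt ℂ k α ∧ a 0 = c ∧
      ∀ᶠ s in 𝓝[≠] α, f s - ∑ i ∈ Finset.range (m + 1), a i / (s - α) ^ (i + 1) = k s := by
  obtain ⟨h, m, hh, hfh, rfl⟩ := hf
  have hh0 : AnalyticAt ℂ (fun z => h (α + z)) 0 :=
    AnalyticAt.fun_comp (by simpa using hh) (by fun_prop)
  obtain ⟨F, hF, hF'⟩ := hh0.exists_eq_sum_add_pow_mul (m + 1)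
  refine ⟨fun i => taylorCoeff h (m - i) α, m, fun s => F (s - α),
    AnalyticAt.fun_comp (by simpa using hF) (by fun_prop), rfl, ?_⟩
  filter_upwards [hfh, self_mem_nhdsWithin] with s hs hne
  have hne' : s - α ≠ 0 := sub_ne_zero.mpr hne
  have := hF' (s - α)
  simp only [add_sub_cancel, smul_eq_mul, iteratedDeriv_comp_const_add, add_zero] at this
  rw [hs, this, add_div, mul_div_cancel_left₀ _ (pow_ne_zero _ hne'),
    ← Finset.sum_range_reflect, Finset.sum_div, add_comm, add_sub_assoc, ← Finset.sum_sub_distrib]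
  convert add_zero _
  refine Finset.sum_eq_zero fun i hi => ?_
  have hi' : i ≤ m := Nat.lt_succ_iff.mp (Finset.mem_range.mp hi)
  have e : (s - α) ^ (m + 1) = (s - α) ^ (m - i) * (s - α) ^ (i + 1) := by
    rw [← pow_add]; congr 1; omega
  rw [show m + 1 - 1 - i = m - i by omega, e, taylorCoeff]
  field_simp
  simp

/-- Removable singularities, treated at all points at once: the extension takes the punctured limit
of `G` everywhere. Near `s` these limits are the values of the local analytic representative `A`,
since `G = A` on an open punctured neighbourhood. -/
theorem exists_differentiable_extension {G : ℂ → ℂ}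
    (hG : ∀ s, ∃ A : ℂ → ℂ, AnalyticAt ℂ A s ∧ G =ᶠ[𝓝[≠] s] A) :
    ∃ E : ℂ → ℂ, Differentiable ℂ E ∧ ∀ s, AnalyticAt ℂ G s → E s = G s := by
  have key : ∀ s (A : ℂ → ℂ), AnalyticAt ℂ A s → G =ᶠ[𝓝[≠] s] A → limUnder (𝓝[≠] s) G = A s :=
    fun s A hA hGA => Tendsto.limUnder_eq
      (((hA.continuousAt.tendsto).mono_left nhdsWithin_le_nhds).congr' hGA.symm)
  refine ⟨fun s => limUnder (𝓝[≠] s) G, fun s => ?_, fun s hs => key s G hs EventuallyEq.rfl⟩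
  obtain ⟨A, hA, hGA⟩ := hG s
  refine hA.differentiableAt.congr_of_eventuallyEq ?_
  have h1 : ∀ᶠ t in 𝓝[≠] s, limUnder (𝓝[≠] t) G = A t := by
    have h2 : ∀ᶠ t in 𝓝[≠] s, ∀ᶠ u in 𝓝 t, G u = A u := by
      have := eventually_eventually_nhdsWithin.mpr hGA
      filter_upwards [this, self_mem_nhdsWithin] with t ht hts
      rwa [IsOpen.nhdsWithin_eq isOpen_compl_singleton hts] at ht
    filter_upwards [h2, hA.eventually_analyticAt.filter_mono nhdsWithin_le_nhds] with t ht hAt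
    exact key t A hAt (nhdsWithin_le_nhds ht)
  rw [eventually_nhdsWithin_iff] at h1
  filter_upwards [h1] with t ht
  by_cases hts : t = s
  · subst hts; exact key t A hA hGA
  · exact ht hts

/-- At infinity, multiplication by `s` detects only the simple-pole term of a principal part, that
is, the residue. -/
theorem tendsto_mul_div_sub_pow (α a : ℂ) (i : ℕ) :
    Tendsto (fun s : ℂ => s * (a / (s - α) ^ (i + 1))) (Bornology.cobounded ℂ)
      (𝓝 (if i = 0 then a else 0)) := by
  have h0 : Tendsto (fun s : ℂ => (s - α)⁻¹) (Bornology.cobounded ℂ) (𝓝 0) :=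
    tendsto_inv₀_cobounded.comp (tendsto_sub_const_cobounded α)
  have h1 : Tendsto (fun s : ℂ => s * (s - α)⁻¹) (Bornology.cobounded ℂ) (𝓝 1) := by
    have : Tendsto (fun s : ℂ => 1 + α * (s - α)⁻¹) (Bornology.cobounded ℂ) (𝓝 1) := by
      simpa using (h0.const_mul α).const_add 1
    refine this.congr' ?_
    filter_upwards [Bornology.eventually_ne_cobounded α] with s hs
    have := sub_ne_zero.mpr hs
    field_simp
    ring
  have h2 := (h1.mul ((h0.pow i))).const_mul a
  convert h2 using 1
  · ext s; rw [div_eq_mul_inv, ← inv_pow, pow_succ]; ring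
  · rcases eq_or_ne i 0 with rfl | hi <;> simp [*]

/-- The residues of a function with finitely many poles that decays faster than `s⁻¹` add up to
zero. -/
theorem sum_residue_eq_zero {F : ℂ → ℂ} {P : Finset ℂ} (hF : ∀ s ∉ P, AnalyticAt ℂ F s)
    (hP : ∀ α ∈ P, ∃ c, HasResidue F α c)
    (h0 : Tendsto (fun s => s * F s) (Bornology.cobounded ℂ) (𝓝 0)) :
    ∑ α ∈ P, residue F α = 0 := by
  have hP' : ∀ α : ℂ, ∃ (a : ℕ → ℂ) (m : ℕ) (k : ℂ → ℂ), α ∈ P →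
      (AnalyticAt ℂ k α ∧ a 0 = residue F α ∧
      ∀ᶠ s in 𝓝[≠] α, F s - ∑ i ∈ Finset.range (m + 1), a i / (s - α) ^ (i + 1) = k s) := by
    intro α
    by_cases hα : α ∈ P
    · obtain ⟨c, hc⟩ := hP α hα
      obtain ⟨a, m, k, h⟩ := hc.exists_principal
      rw [← hc.residue_eq] at h
      exact ⟨a, m, k, fun _ => h⟩
    · exact ⟨0, 0, 0, fun h => absurd h hα⟩
  choose a m k hk using hP'
  set Q : ℂ → ℂ → ℂ := fun α s => ∑ i ∈ Finset.range (m α + 1), a α i / (s - α) ^ (i + 1) with hQ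
  have hQan : ∀ α s, s ≠ α → AnalyticAt ℂ (Q α) s := fun α s hs => by
    refine Finset.analyticAt_fun_sum _ fun i _ => ?_
    have : (s - α) ^ (i + 1) ≠ 0 := pow_ne_zero _ (sub_ne_zero.mpr hs)
    fun_prop (disch := assumption)
  have hQlim : ∀ α, Tendsto (fun s => s * Q α s) (Bornology.cobounded ℂ) (𝓝 (a α 0)) := fun α => by
    have := tendsto_finsetSum (Finset.range (m α + 1))
      fun i (_ : i ∈ Finset.range (m α + 1)) => tendsto_mul_div_sub_pow α (a α i) i
    simpa [hQ, Finset.mul_sum] using this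
  -- Removing all principal parts leaves a function that extends to an entire `E` with `s E(s)`
  -- tending to minus the sum of the residues. Hence `E` tends to `0`, so `E = 0` by Liouville, and
  -- that limit is `0`.
  have hGlim : Tendsto (fun s => s * (F s - ∑ α ∈ P, Q α s)) (Bornology.cobounded ℂ)
      (𝓝 (-∑ α ∈ P, a α 0)) := by
    have := h0.sub (tendsto_finsetSum P fun α _ => hQlim α)
    simpa [mul_sub, Finset.mul_sum] using this
  have hsum : ∑ α ∈ P, residue F α = ∑ α ∈ P, a α 0 :=
    Finset.sum_congr rfl fun α hα => (hk α hα).2.1.symm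
  obtain ⟨E, hE, hEG⟩ := exists_differentiable_extension
    (G := fun s => F s - ∑ α ∈ P, Q α s) fun s => by
      by_cases hs : s ∈ P
      · refine ⟨fun t => k s t - ∑ α ∈ P.erase s, Q α t, (hk s hs).1.sub
          (Finset.analyticAt_fun_sum _ fun α hα => hQan α s (Finset.ne_of_mem_erase hα).symm), ?_⟩
        filter_upwards [(hk s hs).2.2] with t ht
        rw [← ht, ← Finset.add_sum_erase _ _ hs]
        ring
      · exact ⟨_, (hF s hs).sub (Finset.analyticAt_fun_sum _ fun α hα =>
          hQan α s fun h => hs (h ▸ hα)), EventuallyEq.rfl⟩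
  have hEG' : ∀ᶠ s in Bornology.cobounded ℂ, E s = F s - ∑ α ∈ P, Q α s := by
    filter_upwards [Bornology.isBounded_def.mp P.finite_toSet.isBounded] with s hs
    exact hEG s ((hF s hs).sub (Finset.analyticAt_fun_sum _ fun α hα =>
          hQan α s fun h => hs (h ▸ hα)))
  have hElim : Tendsto E (cocompact ℂ) (𝓝 0) := by
    rw [← Metric.cobounded_eq_cocompact]
    have := tendsto_inv₀_cobounded.mul hGlim
    rw [zero_mul] at this
    refine this.congr' ?_
    filter_upwards [hEG', Bornology.eventually_ne_cobounded 0] with s hs hs0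
    rw [hs, inv_mul_cancel_left₀ hs0]
  have hE0 : ∀ s, E s = 0 := fun s => hE.apply_eq_of_tendsto_cocompact s hElim
  have : Tendsto (fun s => s * (F s - ∑ α ∈ P, Q α s)) (Bornology.cobounded ℂ) (𝓝 0) := by
    refine tendsto_const_nhds.congr' ?_
    filter_upwards [hEG'] with s hs
    rw [← hs, hE0, mul_zero]
  rw [hsum, ← neg_eq_zero]
  exact tendsto_nhds_unique hGlim this

/-! ### Values of rational functions -/

/-- Evaluation uses the reduced fraction, whose denominator divides `b` and therefore does not
vanish at `s` either. -/
theorem ratVal_div (a b : Polynomial ℂ) {s : ℂ} (hb : b.eval s ≠ 0) :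
    ratVal (algebraMap _ _ a / algebraMap _ _ b) s = a.eval s / b.eval s := by
  have hb0 : b ≠ 0 := fun h => hb (by simp [h])
  set r : RatFunc ℂ := algebraMap _ _ a / algebraMap _ _ b with hr
  have h1 : r.num * b = a * r.denom := (RatFunc.num_mul_eq_mul_denom_iff hb0).mpr hr
  have h2 : r.denom.eval s ≠ 0 := fun h =>
    hb (Polynomial.eval_eq_zero_of_dvd_of_eval_eq_zero (RatFunc.denom_div_dvd a b) h)
  rw [ratVal, RatFunc.eval, Polynomial.eval₂_id, Polynomial.eval₂_id, div_eq_div_iff h2 hb,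
    ← Polynomial.eval_mul, ← Polynomial.eval_mul, h1]

theorem mem_poles {r : RatFunc ℂ} {s : ℂ} : s ∈ poles r ↔ r.denom.eval s = 0 := by
  simp [poles, Polynomial.mem_roots r.denom_ne_zero]

theorem analyticAt_ratVal {r : RatFunc ℂ} {s : ℂ} (hs : s ∉ poles r) :
    AnalyticAt ℂ (ratVal r) s := by
  rw [mem_poles] at hs
  have : ratVal r = fun t => r.num.eval t / r.denom.eval t := by
    ext t; simp [ratVal, RatFunc.eval, Polynomial.eval₂_id]
  rw [this]
  exact (AnalyticOnNhd.eval_polynomial r.num s (Set.mem_univ _)).div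
    (AnalyticOnNhd.eval_polynomial r.denom s (Set.mem_univ _)) hs

/-- Clearing the pole of a rational function at `α`. -/
theorem ratVal_clear_pole (r : RatFunc ℂ) (α : ℂ) (m : ℕ) (hm : r.denom.rootMultiplicity α = m) :
    AnalyticAt ℂ (ratVal (algebraMap _ _ (Polynomial.X - Polynomial.C α) ^ m * r)) α ∧
    ∀ᶠ s in 𝓝[≠] α, ratVal r s =
      ratVal (algebraMap _ _ (Polynomial.X - Polynomial.C α) ^ m * r) s / (s - α) ^ m := by
  obtain ⟨d, hd, hd'⟩ := Polynomial.exists_eq_pow_rootMultiplicity_mul_and_not_dvd r.denom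
    r.denom_ne_zero α
  rw [hm] at hd
  have hdα : d.eval α ≠ 0 := fun h => hd' (Polynomial.dvd_iff_isRoot.mpr h)
  have hd0 : d ≠ 0 := fun h => hdα (by simp [h])
  have hr : algebraMap _ _ (Polynomial.X - Polynomial.C α) ^ m * r =
      algebraMap _ _ r.num / algebraMap _ (RatFunc ℂ) d := by
    conv_lhs => rw [← RatFunc.num_div_denom r, hd, map_mul, map_pow]
    have h1 : algebraMap (Polynomial ℂ) (RatFunc ℂ) (Polynomial.X - Polynomial.C α) ≠ 0 :=
      RatFunc.algebraMap_ne_zero (Polynomial.X_sub_C_ne_zero α)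
    have h2 : algebraMap (Polynomial ℂ) (RatFunc ℂ) d ≠ 0 := RatFunc.algebraMap_ne_zero hd0
    field_simp
  have hev : ∀ᶠ s in 𝓝 α, d.eval s ≠ 0 := d.continuous.continuousAt.eventually_ne hdα
  have hval : ∀ᶠ s in 𝓝 α, ratVal (algebraMap _ _ (Polynomial.X - Polynomial.C α) ^ m * r) s =
      r.num.eval s / d.eval s := hev.mono fun s hs => by rw [hr, ratVal_div _ _ hs]
  refine ⟨AnalyticAt.congr ?_ (EventuallyEq.symm hval), ?_⟩
  · exact (AnalyticOnNhd.eval_polynomial r.num α (Set.mem_univ _)).div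
      (AnalyticOnNhd.eval_polynomial d α (Set.mem_univ _)) hdα
  · filter_upwards [nhdsWithin_le_nhds hval] with s hs
    rw [hs, ratVal, RatFunc.eval, Polynomial.eval₂_id, Polynomial.eval₂_id, hd]
    simp [div_div, mul_comm]

/-! ### Sums of partial fractions -/

/-- The rational function `∑_{m ∈ S} y^m / (s + m)^p`. -/
def poleSum (p : ℕ) (y : ℂ) (S : Finset ℤ) (s : ℂ) : ℂ := ∑ m ∈ S, y ^ m / (s + m) ^ p

theorem analyticAt_poleSum {p : ℕ} {y : ℂ} {S : Finset ℤ} {s : ℂ} (hs : ∀ m ∈ S, s + m ≠ 0) :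
    AnalyticAt ℂ (poleSum p y S) s := by
  refine Finset.analyticAt_fun_sum _ fun m hm => ?_
  have := pow_ne_zero p (hs m hm)
  fun_prop (disch := assumption)

theorem taylorCoeff_comp_add (f : ℂ → ℂ) (n a : ℂ) (k : ℕ) :
    taylorCoeff (fun s => f (s + n)) k a = taylorCoeff f k (a + n) := by
  simp only [taylorCoeff, iteratedDeriv_comp_add_const]

theorem taylorCoeff_inv_pow (p : ℕ) (m a : ℂ) (k : ℕ) (hp : 1 ≤ p) :
    taylorCoeff (fun s => 1 / (s + m) ^ p) k a =
      ((k + p - 1).choose (p - 1) : ℂ) * (-1) ^ k / (a + m) ^ (k + p) := by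
  have h1 : (fun s : ℂ => 1 / (s + m) ^ p) = fun s => (fun z : ℂ => z ^ (-p : ℤ)) (s + m) := by
    ext s; simp
  rw [h1, taylorCoeff_comp_add fun z : ℂ => z ^ (-p : ℤ)]
  have h2 : (∏ i ∈ Finset.range k, (((-p : ℤ) : ℂ) - i)) =
      (-1) ^ k * ((k + p - 1).choose (p - 1) : ℂ) * k.factorial := by
    have e : ∀ i ∈ Finset.range k, (((-p : ℤ) : ℂ) - i) = (-1) * ((p + i : ℕ) : ℂ) := by
      intro i _; push_cast; ring
    rw [Finset.prod_congr rfl e, Finset.prod_mul_distrib, Finset.prod_const, Finset.card_range,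
      mul_assoc, ← Nat.cast_prod, ← Nat.ascFactorial_eq_prod_range]
    congr 1
    obtain ⟨p, rfl⟩ : ∃ p', p = p' + 1 := ⟨p - 1, by omega⟩
    rw [Nat.ascFactorial_eq_factorial_mul_choose, show k + (p + 1) - 1 = p + k by omega,
      Nat.add_sub_cancel, Nat.choose_symm_add]
    push_cast; ring
  have h3 : ((k.factorial : ℕ) : ℂ) ≠ 0 := by exact_mod_cast k.factorial_ne_zero
  rw [taylorCoeff, iteratedDeriv_eq_iterate, iter_deriv_zpow, h2,
    show (-p - k : ℤ) = -((k + p : ℕ) : ℤ) by push_cast; ring, zpow_neg, zpow_natCast]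
  field_simp

theorem taylorCoeff_poleSum {p : ℕ} (hp : 1 ≤ p) {y : ℂ} {S : Finset ℤ} {a : ℂ}
    (ha : ∀ m ∈ S, a + m ≠ 0) (k : ℕ) :
    taylorCoeff (poleSum p y S) k a =
      ((k + p - 1).choose (p - 1) : ℂ) * (-1) ^ k * poleSum (k + p) y S a := by
  have h : ∀ m ∈ S, ContDiffAt ℂ k (fun s : ℂ => y ^ m / (s + m) ^ p) a := fun m hm => by
    have := pow_ne_zero p (ha m hm)
    exact AnalyticAt.contDiffAt (by fun_prop (disch := assumption))
  have e : poleSum p y S = fun s => ∑ m ∈ S, y ^ m / (s + m) ^ p := rfl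
  rw [taylorCoeff, e, iteratedDeriv_fun_sum h, Finset.sum_div, poleSum, Finset.mul_sum]
  refine Finset.sum_congr rfl fun m hm => ?_
  have := taylorCoeff_inv_pow p m a k hp
  simp_rw [div_eq_mul_one_div (y ^ m)]
  rw [iteratedDeriv_const_mul_field, mul_div_assoc, ← taylorCoeff, this]
  ring

/-- The numerator of `poleSum p y S` at its pole `-n`. -/
def poleNum (p : ℕ) (y : ℂ) (S : Finset ℤ) (n : ℤ) (s : ℂ) : ℂ :=
  y ^ n * (1 + (s + n) ^ p * poleSum p y ((S.erase n).image (· - n)) (s + n))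

theorem poleSum_image_sub (p : ℕ) {y : ℂ} (hy : y ≠ 0) (S : Finset ℤ) (n : ℤ) (s : ℂ) :
    y ^ n * poleSum p y (S.image (· - n)) (s + n) = poleSum p y S s := by
  rw [poleSum, Finset.sum_image fun a _ b _ h => sub_left_injective h, poleSum, Finset.mul_sum]
  refine Finset.sum_congr rfl fun m _ => ?_
  rw [zpow_sub₀ hy, show s + n + ((m - n : ℤ) : ℂ) = s + m by push_cast; ring]
  field_simp

theorem poleSum_eq_poleNum (p : ℕ) {y : ℂ} (hy : y ≠ 0) {S : Finset ℤ} {n : ℤ} (hn : n ∈ S) {s : ℂ}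
    (hs : s ≠ -n) : poleSum p y S s = poleNum p y S n s / (s + n) ^ p := by
  have h : s + n ≠ 0 := fun h => hs (eq_neg_of_add_eq_zero_left h)
  rw [poleNum, mul_add, mul_left_comm, poleSum_image_sub p hy, poleSum,
    ← Finset.add_sum_erase _ _ hn, poleSum]
  field_simp

theorem zero_add_mem_image_ne_zero (S : Finset ℤ) (n : ℤ) :
    ∀ m ∈ (S.erase n).image (· - n), (0 : ℂ) + m ≠ 0 := by
  intro m hm
  obtain ⟨k, hk, rfl⟩ := Finset.mem_image.mp hm
  rw [zero_add]
  exact_mod_cast sub_ne_zero.mpr (Finset.ne_of_mem_erase hk)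

theorem analyticAt_poleSum_shift (p : ℕ) (y : ℂ) (S : Finset ℤ) (n : ℤ) :
    AnalyticAt ℂ (fun s => poleSum p y ((S.erase n).image (· - n)) (s + n)) (-n) := by
  refine AnalyticAt.fun_comp ?_ (by fun_prop)
  rw [neg_add_cancel]
  exact analyticAt_poleSum (zero_add_mem_image_ne_zero S n)

theorem analyticAt_poleNum (p : ℕ) (y : ℂ) (S : Finset ℤ) (n : ℤ) :
    AnalyticAt ℂ (poleNum p y S n) (-n) := by
  have := analyticAt_poleSum_shift p y S n
  unfold poleNum
  fun_prop

/-- The Taylor coefficients of the regular part of `poleSum p y S` at its pole `-n`. -/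
def regCoeff (p : ℕ) (y : ℂ) (S : Finset ℤ) (n : ℤ) (k : ℕ) : ℂ :=
  ((k + p - 1).choose (p - 1) : ℂ) * (-1) ^ k * poleSum (k + p) y ((S.erase n).image (· - n)) 0

theorem taylorSeries_pow_shift (p : ℕ) (n : ℂ) :
    taylorSeries (fun s => (s + n) ^ p) (-n) = PowerSeries.X ^ p := by
  ext k
  rw [coeff_taylorSeries, taylorCoeff_comp_add (fun s => s ^ p), neg_add_cancel, taylorCoeff,
    iteratedDeriv_fun_pow_zero, PowerSeries.coeff_X_pow]
  split_ifs with h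
  · have : (p.factorial : ℂ) ≠ 0 := by exact_mod_cast p.factorial_ne_zero
    subst h; simp [this]
  · simp

theorem taylorSeries_poleNum {p : ℕ} (hp : 1 ≤ p) (y : ℂ) (S : Finset ℤ) (n : ℤ) :
    taylorSeries (poleNum p y S n) (-n) =
      PowerSeries.C (y ^ n) * (1 + PowerSeries.X ^ p * PowerSeries.mk (regCoeff p y S n)) := by
  have h1 := analyticAt_poleSum_shift p y S n
  have h2 : taylorSeries (fun s => poleSum p y ((S.erase n).image (· - n)) (s + n)) (-n) =
      PowerSeries.mk (regCoeff p y S n) := by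
    ext k
    rw [coeff_taylorSeries, PowerSeries.coeff_mk, regCoeff,
      ← taylorCoeff_poleSum hp (zero_add_mem_image_ne_zero S n),
      taylorCoeff_comp_add, neg_add_cancel]
  rw [← h2, ← taylorSeries_pow_shift, ← taylorSeries_mul (by fun_prop) h1]
  ext k
  have hc : ContDiffAt ℂ k (fun s : ℂ => (s + n) ^ p *
      poleSum p y ((S.erase n).image (· - n)) (s + n)) (-n) :=
    AnalyticAt.contDiffAt (by fun_prop)
  rw [coeff_taylorSeries, PowerSeries.coeff_C_mul, map_add, coeff_taylorSeries, taylorCoeff]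
  unfold poleNum
  rw [iteratedDeriv_const_mul_field, iteratedDeriv_fun_add contDiffAt_const hc, mul_div_assoc,
    add_div, taylorCoeff]
  congr 2
  rw [iteratedDeriv_const, PowerSeries.coeff_one]
  split_ifs with h
  · subst h; simp
  · simp

/-- Multiplying out the two binomials gives four products, one for each group of terms contributed
by the pole at `0` in the final formula. -/
theorem coeff_one_add_mul_one_add_mul {p : ℕ} (hp : 1 ≤ p) (q : ℕ) (b c : ℕ → ℂ)
    (R : PowerSeries ℂ) :
    PowerSeries.coeff (p + q) ((1 + PowerSeries.X * PowerSeries.mk c) *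
      ((1 + PowerSeries.X ^ p * PowerSeries.mk b) * R)) =
    PowerSeries.coeff (p + q) R
      + ∑ k ∈ Finset.range (q + 1), b k * PowerSeries.coeff (q - k) R
      + ∑ k ∈ Finset.range (p + q), c k * PowerSeries.coeff (p + q - k - 1) R
      + ∑ k₁ ∈ Finset.range q, ∑ k₂ ∈ Finset.range (q - k₁),
          c k₁ * b k₂ * PowerSeries.coeff (q - k₁ - k₂ - 1) R := by
  have hmul : ∀ (f : ℕ → ℂ) (A : PowerSeries ℂ) (n : ℕ),
      PowerSeries.coeff n (PowerSeries.mk f * A) =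
        ∑ k ∈ Finset.range (n + 1), f k * PowerSeries.coeff (n - k) A := fun f A n => by
    rw [PowerSeries.coeff_mul, Finset.Nat.sum_antidiagonal_eq_sum_range_succ_mk]
    simp
  have e : (1 + PowerSeries.X * PowerSeries.mk c) *
      ((1 + PowerSeries.X ^ p * PowerSeries.mk b) * R) =
      R + PowerSeries.X ^ p * (PowerSeries.mk b * R) +
      PowerSeries.X ^ 1 * (PowerSeries.mk c * R) +
      PowerSeries.X ^ (p + 1) * (PowerSeries.mk c * (PowerSeries.mk b * R)) := by ring
  rw [e, map_add, map_add, map_add, PowerSeries.coeff_X_pow_mul', PowerSeries.coeff_X_pow_mul',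
    PowerSeries.coeff_X_pow_mul', if_pos (by omega), if_pos (by omega), Nat.add_sub_cancel_left,
    hmul b, hmul c R, show p + q - 1 + 1 = p + q by omega]
  congr 1
  · congr 1
    exact Finset.sum_congr rfl fun k _ => by rw [show p + q - 1 - k = p + q - k - 1 by omega]
  -- For `q = 0` the shift `p + 1` exceeds the degree `p + q`, and the double sum is empty.
  · rcases Nat.eq_zero_or_pos q with rfl | hq
    · simp
    · rw [if_pos (by omega), hmul, show p + q - (p + 1) = q - 1 by omega,
        show q - 1 + 1 = q by omega]
      refine Finset.sum_congr rfl fun k hk => ?_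
      have hk := Finset.mem_range.mp hk
      rw [hmul, Finset.mul_sum, show q - 1 - k + 1 = q - k by omega]
      refine Finset.sum_congr rfl fun j _ => ?_
      rw [show q - 1 - k - j = q - k - j - 1 by omega]
      ring

/-! ### The truncated kernel -/

/-- The integrand with the two series cut off to `S` and `T`. -/
def truncated (p : ℕ) (x y : ℂ) (S T : Finset ℤ) (r : RatFunc ℂ) (s : ℂ) : ℂ :=
  poleSum 1 x S s * poleSum p y T s * ratVal r s

theorem tendsto_poleSum_cobounded {p : ℕ} (hp : 1 ≤ p) (y : ℂ) (S : Finset ℤ) :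
    Tendsto (poleSum p y S) (Bornology.cobounded ℂ) (𝓝 0) := by
  have h : ∀ m ∈ S, Tendsto (fun s : ℂ => y ^ m / (s + m) ^ p) (Bornology.cobounded ℂ) (𝓝 0) := by
    intro m _
    have h0 : Tendsto (fun s : ℂ => (s + m)⁻¹) (Bornology.cobounded ℂ) (𝓝 0) :=
      tendsto_inv₀_cobounded.comp (tendsto_add_const_cobounded (m : ℂ))
    have h1 := (h0.pow p).const_mul (y ^ m)
    rw [zero_pow (by omega), mul_zero] at h1
    simpa [div_eq_mul_inv] using h1
  simpa [poleSum] using! tendsto_finsetSum S h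

/-- The weaker decay `O(s⁻¹)` of `r` suffices: `s r(s)` is bounded and each truncated sum is `o(1)`.
-/
theorem tendsto_mul_truncated {p : ℕ} (hp : 1 ≤ p) (x y : ℂ) (S T : Finset ℤ) {r : RatFunc ℂ}
    (hr : ratVal r =O[Bornology.cobounded ℂ] fun s : ℂ => s⁻¹) :
    Tendsto (fun s => s * truncated p x y S T r s) (Bornology.cobounded ℂ) (𝓝 0) := by
  have h1 : (fun s => s * ratVal r s) =O[Bornology.cobounded ℂ] fun _ : ℂ => (1 : ℂ) := by
    refine ((isBigO_refl (fun s : ℂ => s) _).mul hr).trans (IsBigO.of_bound 1 ?_)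
    filter_upwards with s
    by_cases hs : s = 0 <;> simp [hs]
  have h2 : (poleSum 1 x S) =o[Bornology.cobounded ℂ] fun _ : ℂ => (1 : ℂ) :=
    (isLittleO_one_iff ℂ).mpr (tendsto_poleSum_cobounded le_rfl x S)
  have h3 : (poleSum p y T) =o[Bornology.cobounded ℂ] fun _ : ℂ => (1 : ℂ) :=
    (isLittleO_one_iff ℂ).mpr (tendsto_poleSum_cobounded hp y T)
  have h4 := (h2.mul h3).mul_isBigO h1
  simp only [mul_one] at h4
  refine ((isLittleO_one_iff ℂ).mp h4).congr fun s => ?_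
  rw [truncated]; ring

theorem hasResidue_truncated_simple {p : ℕ} {x y : ℂ} (hx : x ≠ 0) {S T : Finset ℤ}
    {r : RatFunc ℂ} {n : ℤ} (hS : n ∈ S) (hT : n ∉ T) (hr : (-n : ℂ) ∉ poles r) :
    HasResidue (truncated p x y S T r) (-n) (x ^ n * poleSum p y T (-n) * ratVal r (-n)) := by
  have hT' : ∀ m ∈ T, (-n : ℂ) + m ≠ 0 := fun m hm h => hT (by
    have : (m : ℂ) = n := by linear_combination h
    rwa [← Int.cast_injective this])
  refine ⟨fun s => poleNum 1 x S n s * poleSum p y T s * ratVal r s, 0,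
    ((analyticAt_poleNum 1 x S n).fun_mul (analyticAt_poleSum hT')).fun_mul (analyticAt_ratVal hr),
    ?_, ?_⟩
  · filter_upwards [self_mem_nhdsWithin] with s hs
    rw [truncated, poleSum_eq_poleNum 1 hx hS hs, sub_neg_eq_add]
    ring
  · simp [taylorCoeff, poleNum]

/-- The residue of `(t⁻¹ + ∑ c_k t^k) (t⁻ᵖ + ∑ b_k t^k) ∑ T_k t^(k - q)` at `t = 0`. -/
def localResidue (p q : ℕ) (b c T : ℕ → ℂ) : ℂ :=
  T (p + q) + ∑ k ∈ Finset.range (q + 1), b k * T (q - k)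
    + ∑ k ∈ Finset.range (p + q), c k * T (p + q - k - 1)
    + ∑ k₁ ∈ Finset.range q, ∑ k₂ ∈ Finset.range (q - k₁), c k₁ * b k₂ * T (q - k₁ - k₂ - 1)

theorem tendsto_localResidue (p q : ℕ) {b c : ℕ → ℕ → ℂ} {b' c' : ℕ → ℂ} (T : ℕ → ℂ)
    (hb : ∀ k, Tendsto (fun n => b n k) atTop (𝓝 (b' k)))
    (hc : ∀ k, Tendsto (fun n => c n k) atTop (𝓝 (c' k))) :
    Tendsto (fun n => localResidue p q (b n) (c n) T) atTop (𝓝 (localResidue p q b' c' T)) := by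
  refine ((tendsto_const_nhds.add ?_).add ?_).add ?_
  · exact tendsto_finsetSum _ fun k _ => (hb k).mul_const _
  · exact tendsto_finsetSum _ fun k _ => (hc k).mul_const _
  · exact tendsto_finsetSum _ fun k _ => tendsto_finsetSum _ fun j _ =>
      ((hc k).mul (hb j)).mul_const _

/-- The factors have poles of orders at most `1`, `p` and `q` at `-n`, so the residue is the
coefficient of degree `p + q` in the product of the Taylor series of their numerators. -/
theorem hasResidue_truncated_pole {p : ℕ} (hp : 1 ≤ p) {x y : ℂ} (hx : x ≠ 0) (hy : y ≠ 0)
    {S T : Finset ℤ} {r : RatFunc ℂ} {n : ℤ} (hS : n ∈ S) (hT : n ∈ T) {R : ℂ → ℂ} {q : ℕ}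
    (hR : AnalyticAt ℂ R (-n)) (hrR : ∀ᶠ s in 𝓝[≠] (-n : ℂ), ratVal r s = R s / (s + n) ^ q) :
    HasResidue (truncated p x y S T r) (-n) ((x * y) ^ n *
      localResidue p q (regCoeff p y T n) (regCoeff 1 x S n) fun j => taylorCoeff R j (-n)) := by
  have hA := analyticAt_poleNum 1 x S n
  have hB := analyticAt_poleNum p y T n
  refine ⟨fun s => poleNum 1 x S n s * (poleNum p y T n s * R s), p + q,
    hA.fun_mul (hB.fun_mul hR), ?_, ?_⟩
  · filter_upwards [self_mem_nhdsWithin, hrR] with s hs hr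
    have h : s + n ≠ 0 := fun h => hs (eq_neg_of_add_eq_zero_left h)
    rw [truncated, poleSum_eq_poleNum 1 hx hS hs, poleSum_eq_poleNum p hy hT hs, hr, sub_neg_eq_add]
    field_simp
    ring
  · rw [← coeff_taylorSeries (fun s => poleNum 1 x S n s * (poleNum p y T n s * R s)),
      taylorSeries_mul hA (hB.fun_mul hR), taylorSeries_mul hB hR,
      taylorSeries_poleNum le_rfl, taylorSeries_poleNum hp, pow_one]
    have := coeff_one_add_mul_one_add_mul hp q (regCoeff p y T n) (regCoeff 1 x S n)
      (taylorSeries R (-n))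
    simp only [coeff_taylorSeries] at this
    rw [localResidue, ← this, mul_zpow, ← PowerSeries.coeff_C_mul,
      map_mul PowerSeries.C (x ^ n) (y ^ n)]
    congr 1
    ring

theorem hasResidue_truncated_ratVal {p : ℕ} {x y : ℂ} {S T : Finset ℤ} {r : RatFunc ℂ} {α : ℂ}
    (hα : ∀ n : ℤ, α + n ≠ 0) {h : ℂ → ℂ} {m : ℕ} (hh : AnalyticAt ℂ h α)
    (hr : ∀ᶠ s in 𝓝[≠] α, ratVal r s = h s / (s - α) ^ (m + 1)) :
    HasResidue (truncated p x y S T r) α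
      (taylorCoeff (fun s => poleSum 1 x S s * poleSum p y T s * h s) m α) := by
  refine ⟨_, m, ((analyticAt_poleSum fun n _ => hα n).fun_mul
    (analyticAt_poleSum fun n _ => hα n)).fun_mul hh, ?_, rfl⟩
  filter_upwards [hr] with s hs
  rw [truncated, hs, mul_div_assoc]

theorem sum_image_Icc_neg (f : ℂ → ℂ) (N : ℕ) :
    ∑ α ∈ (Finset.Icc (-N : ℤ) N).image (fun n : ℤ => (n : ℂ)), f α =
      f 0 + ∑ n ∈ Finset.Icc 1 N, (f n + f (-n)) := by
  rw [Finset.sum_image fun a _ b _ h => Int.cast_injective h]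
  induction N with
  | zero => simp
  | succ N ih =>
    have e : Finset.Icc (-(N + 1 : ℕ) : ℤ) (N + 1 : ℕ) =
        insert ((N + 1 : ℕ) : ℤ) (insert (-(N + 1 : ℕ) : ℤ) (Finset.Icc (-N : ℤ) N)) := by
      ext k; simp only [Finset.mem_Icc, Finset.mem_insert]; omega
    rw [e, Finset.sum_insert, Finset.sum_insert, ih, Finset.sum_Icc_succ_top (by omega)]
    · push_cast; ring
    · simp
    · simp; omega

/-- Three kinds of points occur: `-n` with `n` in both cut-offs, `-n` with `n` in `S` only (where
`r` is regular, since `0 ∈ T` forces `n ≠ 0`), and non-integral poles of `r`. -/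
theorem exists_hasResidue_truncated {p : ℕ} (hp : 1 ≤ p) {x y : ℂ} (hx : x ≠ 0) (hy : y ≠ 0)
    {r : RatFunc ℂ} (hpoles : ∀ n : ℤ, n ≠ 0 → (n : ℂ) ∉ poles r) {S T : Finset ℤ} {α : ℂ}
    (hα : α ∈ (poles r).erase 0 ∨ ∃ n ∈ S, α = -(n : ℂ)) (h0S : 0 ∈ S) (h0 : 0 ∈ T) :
    ∃ c, HasResidue (truncated p x y S T r) α c := by
  by_cases hint : ∃ n : ℤ, α = -(n : ℂ)
  · obtain ⟨n, rfl⟩ := hint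
    have hnS : n ∈ S := by
      rcases hα with h | ⟨m, hm, h⟩
      · rcases eq_or_ne n 0 with rfl | hn
        · exact h0S
        · exact absurd (Finset.mem_of_mem_erase h)
            (by simpa using hpoles (-n) (neg_ne_zero.mpr hn))
      · rwa [Int.cast_injective (neg_injective h)]
    by_cases hnT : n ∈ T
    · obtain ⟨h1, h2⟩ := ratVal_clear_pole r (-n) _ rfl
      simp_rw [sub_neg_eq_add] at h2
      exact ⟨_, hasResidue_truncated_pole hp hx hy hnS hnT h1 h2⟩
    · refine ⟨_, hasResidue_truncated_simple hx hnS hnT ?_⟩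
      have : n ≠ 0 := fun h => hnT (h ▸ h0)
      simpa using hpoles (-n) (neg_ne_zero.mpr this)
  · obtain ⟨h1, h2⟩ := ratVal_clear_pole r α _ rfl
    have hα' : α ∈ poles r := by
      rcases hα with h | ⟨m, hm, h⟩
      · exact Finset.mem_of_mem_erase h
      · exact absurd ⟨m, h⟩ hint
    have hpos : 0 < r.denom.rootMultiplicity α :=
      (Polynomial.rootMultiplicity_pos r.denom_ne_zero).mpr (mem_poles.mp hα')
    obtain ⟨m, hm⟩ := Nat.exists_eq_succ_of_ne_zero hpos.ne'
    rw [hm] at h1 h2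
    exact ⟨_, hasResidue_truncated_ratVal (fun n h => hint ⟨n, eq_neg_of_add_eq_zero_left h⟩) h1 h2⟩

/-- The sum of all residues of the truncated integrand vanishes. -/
theorem sum_residue_truncated {p : ℕ} (hp : 1 ≤ p) {x y : ℂ} (hx : x ≠ 0) (hy : y ≠ 0)
    {r : RatFunc ℂ} (hr : ratVal r =O[Bornology.cobounded ℂ] fun s : ℂ => s⁻¹)
    (hpoles : ∀ n : ℤ, n ≠ 0 → (n : ℂ) ∉ poles r) {M N : ℕ} (hMN : M ≤ N) :
    let F := truncated p x y (Finset.Icc (-N : ℤ) N) (Finset.Icc 0 (M : ℤ)) r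
    ∑ α ∈ (poles r).erase 0, residue F α + residue F 0 + ∑ n ∈ Finset.Icc 1 M, residue F (-n)
      + ∑ n ∈ Finset.Icc 1 N, (x ^ n)⁻¹ * poleSum p y (Finset.Icc 0 (M : ℤ)) n * ratVal r n
      + ∑ n ∈ Finset.Icc (M + 1) N,
          x ^ n * poleSum p y (Finset.Icc 0 (M : ℤ)) (-n) * ratVal r (-n) = 0 := by
  intro F
  have hneg : ∀ n : ℤ, n ∈ Finset.Icc (-N : ℤ) N ↔ -n ∈ Finset.Icc (-N : ℤ) N := fun n => by
    simp only [Finset.mem_Icc]; omega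
  have h0 := sum_residue_eq_zero (F := F)
    (P := (poles r).erase 0 ∪ (Finset.Icc (-N : ℤ) N).image fun n : ℤ => (n : ℂ)) ?_ ?_
    (tendsto_mul_truncated hp x y _ _ hr)
  · rw [Finset.sum_union, sum_image_Icc_neg, Finset.sum_add_distrib] at h0
    -- The poles of `poleSum` lie at the negatives of its indices, so the residue at `n > 0` belongs
    -- to the index `-n`, which is outside `[0, M]`.
    · have e1 : ∑ n ∈ Finset.Icc 1 N, residue F n = ∑ n ∈ Finset.Icc 1 N,
          (x ^ n)⁻¹ * poleSum p y (Finset.Icc 0 (M : ℤ)) n * ratVal r n := by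
        refine Finset.sum_congr rfl fun n hn => ?_
        have hn' := Finset.mem_Icc.mp hn
        have := (hasResidue_truncated_simple (p := p) (y := y) (S := Finset.Icc (-N : ℤ) N)
          (T := Finset.Icc 0 (M : ℤ)) (r := r) hx (n := -n) (by simp; omega) (by simp; omega)
          (by simpa using hpoles n (by omega))).residue_eq
        simpa using this
      have e2 : ∑ n ∈ Finset.Icc (M + 1) N, residue F (-n) = ∑ n ∈ Finset.Icc (M + 1) N,
          x ^ n * poleSum p y (Finset.Icc 0 (M : ℤ)) (-n) * ratVal r (-n) := by
        refine Finset.sum_congr rfl fun n hn => ?_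
        have hn' := Finset.mem_Icc.mp hn
        have := (hasResidue_truncated_simple (p := p) (y := y) (S := Finset.Icc (-N : ℤ) N)
          (T := Finset.Icc 0 (M : ℤ)) (r := r) hx (n := n) (by simp; omega) (by simp; omega)
          (by simpa using hpoles (-n) (by omega))).residue_eq
        simpa using this
      have e3 : ∑ n ∈ Finset.Icc 1 N, residue F (-n) = ∑ n ∈ Finset.Icc 1 M, residue F (-n)
          + ∑ n ∈ Finset.Icc (M + 1) N, residue F (-n) := by
        rw [← Finset.sum_union]
        · congr 1; ext k; simp only [Finset.mem_Icc, Finset.mem_union]; omega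
        · rw [Finset.disjoint_left]; intro k; simp only [Finset.mem_Icc]; omega
      rw [← e1, ← e2]
      rw [e3] at h0
      linear_combination h0
    · rw [Finset.disjoint_left]
      intro α hα hα'
      obtain ⟨n, _, rfl⟩ := Finset.mem_image.mp hα'
      obtain ⟨h1, h2⟩ := Finset.mem_erase.mp hα
      exact hpoles n (by rintro rfl; simp at h1) h2
  · intro s hs
    rw [Finset.mem_union, not_or] at hs
    have hS : ∀ m ∈ Finset.Icc (-N : ℤ) N, s + m ≠ 0 := fun m hm h => hs.2
      (Finset.mem_image.mpr ⟨-m, (hneg m).mp hm, by push_cast; linear_combination -h⟩)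
    have hs0 : s ≠ 0 := by simpa using hS 0 (by simp)
    have hT : ∀ m ∈ Finset.Icc (0 : ℤ) M, s + m ≠ 0 := fun m hm => hS m (by
      simp only [Finset.mem_Icc] at hm ⊢; omega)
    exact ((analyticAt_poleSum hS).fun_mul (analyticAt_poleSum hT)).fun_mul
      (analyticAt_ratVal fun h => hs.1 (Finset.mem_erase.mpr ⟨hs0, h⟩))
  · intro α hα
    refine exists_hasResidue_truncated hp hx hy hpoles ?_ (by simp) (by simp)
    rcases Finset.mem_union.mp hα with h | h
    · exact Or.inl h
    · obtain ⟨n, hn, rfl⟩ := Finset.mem_image.mp h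
      exact Or.inr ⟨-n, (hneg n).mp hn, by simp⟩

/-! ### Tails of polylogarithms -/

/-- Abel summation: multiplication by `1 - y` turns the sum into a telescoping sum of the decrements
of `f`. The induction carries the boundary term `y^(M+1) f M` along with the sharper bound `2 f 0 -
f M`. -/
theorem norm_sum_pow_mul_le_of_antitone {y : ℂ} (hy : ‖y‖ = 1) {f : ℕ → ℝ} (hf : Antitone f)
    (hf0 : ∀ k, 0 ≤ f k) (M : ℕ) : ‖(1 - y) * ∑ k ∈ Finset.range M, y ^ k * f k‖ ≤ 2 * f 0 := by
  have key : ∀ M, ‖(1 - y) * ∑ k ∈ Finset.range (M + 1), y ^ k * f k + y ^ (M + 1) * f M‖ ≤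
      2 * f 0 - f M := by
    intro M
    induction M with
    | zero =>
      have : (1 - y) * ∑ k ∈ Finset.range (0 + 1), y ^ k * f k + y ^ (0 + 1) * f 0 = f 0 := by
        simp; ring
      rw [this, Complex.norm_real, Real.norm_of_nonneg (hf0 0)]
      linarith
    | succ M ih =>
      rw [Finset.sum_range_succ]
      have e : (1 - y) * (∑ k ∈ Finset.range (M + 1), y ^ k * f k + y ^ (M + 1) * f (M + 1)) +
          y ^ (M + 1 + 1) * f (M + 1) = ((1 - y) * ∑ k ∈ Finset.range (M + 1), y ^ k * f k +
          y ^ (M + 1) * f M) + y ^ (M + 1) * ((f (M + 1) - f M : ℝ) : ℂ) := by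
        push_cast; ring
      have h1 : ‖y ^ (M + 1) * ((f (M + 1) - f M : ℝ) : ℂ)‖ = f M - f (M + 1) := by
        rw [norm_mul, norm_pow, hy, one_pow, one_mul, Complex.norm_real, Real.norm_eq_abs,
          abs_of_nonpos (sub_nonpos.mpr (hf M.le_succ)), neg_sub]
      rw [e]
      linarith [norm_add_le ((1 - y) * ∑ k ∈ Finset.range (M + 1), y ^ k * f k +
          y ^ (M + 1) * f M) (y ^ (M + 1) * ((f (M + 1) - f M : ℝ) : ℂ))]
  rcases M with _ | M
  · simpa using hf0 0
  · have h1 : ‖y ^ (M + 1) * (f M : ℂ)‖ = f M := by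
      rw [norm_mul, norm_pow, hy, one_pow, one_mul, Complex.norm_real, Real.norm_of_nonneg (hf0 M)]
    have h2 := norm_sub_le ((1 - y) * ∑ k ∈ Finset.range (M + 1), y ^ k * f k + y ^ (M + 1) * f M)
      (y ^ (M + 1) * f M)
    rw [add_sub_cancel_right] at h2
    linarith [key M]

theorem sum_one_div_sq_le {n : ℕ} (hn : 1 ≤ n) (M : ℕ) :
    ∑ k ∈ Finset.range M, 1 / ((k : ℝ) + n) ^ 2 ≤ 2 / (n : ℝ) := by
  have hn' : (1 : ℝ) ≤ n := by exact_mod_cast hn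
  have key : ∑ k ∈ Finset.range M, 1 / ((k : ℝ) + n) ^ 2 ≤ 2 / (n : ℝ) - 2 / ((n : ℝ) + M) := by
    induction M with
    | zero => simp
    | succ M ih =>
      rw [Finset.sum_range_succ]
      have ha : (1 : ℝ) ≤ M + n := by linarith [(Nat.cast_nonneg M : (0 : ℝ) ≤ M)]
      -- With `a = M + n` the right side is `2 / (a (a + 1))`, so the inequality amounts to `a ≥ 1`.
      have : 1 / ((M : ℝ) + n) ^ 2 ≤ 2 / (n + M) - 2 / (n + (M + 1 : ℕ)) := by
        push_cast
        rw [add_comm (n : ℝ) M, show (n : ℝ) + (M + 1) = M + n + 1 by ring]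
        generalize (M : ℝ) + n = a at ha
        rw [div_sub_div _ _ (by positivity) (by positivity), div_le_div_iff₀ (by positivity)
          (by positivity)]
        nlinarith [mul_nonneg (by linarith : (0 : ℝ) ≤ a) (by linarith : (0 : ℝ) ≤ a - 1)]
      linarith
  have : 0 ≤ 2 / ((n : ℝ) + M) := by positivity
  linarith

/-- The tails of `Li_p(y)` are uniformly `O(n⁻¹)`. -/
theorem exists_norm_tail_le {p : ℕ} (hp : 1 ≤ p) {y : ℂ} (hy : ‖y‖ = 1) (hpy : (p, y) ≠ (1, 1)) :
    ∃ C : ℝ, 0 ≤ C ∧ ∀ n : ℕ, 1 ≤ n → ∀ M : ℕ,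
      ‖∑ k ∈ Finset.range M, y ^ k / ((k : ℂ) + n) ^ p‖ ≤ C / n := by
  -- If `y = 1` then `p ≥ 2` and comparison with the sum of inverse squares gives `C = 2`; otherwise
  -- Abel summation gives `C = 2 / ‖1 - y‖`.
  by_cases hy1 : y = 1
  · subst hy1
    have hp2 : 2 ≤ p := by
      rcases hp.lt_or_eq with h | h
      · exact h
      · exact absurd (by rw [← h]) hpy
    refine ⟨2, by norm_num, fun n hn M => le_trans ?_ (sum_one_div_sq_le hn M)⟩
    refine (norm_sum_le _ _).trans (Finset.sum_le_sum fun k _ => ?_)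
    rw [one_pow, norm_div, norm_one, norm_pow,
      show (k : ℂ) + n = ((k + n : ℕ) : ℂ) by push_cast; rfl, Complex.norm_natCast, Nat.cast_add]
    have : (1 : ℝ) ≤ (k : ℝ) + n := by
      exact_mod_cast (by omega : 1 ≤ k + n)
    exact one_div_le_one_div_of_le (by positivity) (pow_le_pow_right₀ this hp2)
  · have hy1' : 0 < ‖1 - y‖ := norm_pos_iff.mpr (sub_ne_zero.mpr (Ne.symm hy1))
    refine ⟨2 / ‖1 - y‖, by positivity, fun n hn M => ?_⟩
    have hn' : (1 : ℝ) ≤ n := by exact_mod_cast hn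
    have hanti : Antitone fun k : ℕ => 1 / ((k : ℝ) + n) ^ p := fun a b hab => by
      have : (a : ℝ) ≤ b := by exact_mod_cast hab
      have : 0 < (a : ℝ) + n := by positivity
      beta_reduce
      gcongr
    have h := norm_sum_pow_mul_le_of_antitone hy hanti (fun k => by positivity) M
    have h2 : 1 / (((0 : ℕ) : ℝ) + n) ^ p ≤ 1 / n := by
      rw [Nat.cast_zero, zero_add]
      exact one_div_le_one_div_of_le (by positivity) (le_self_pow₀ hn' (by omega))
    rw [norm_mul] at h
    have e : ∑ k ∈ Finset.range M, y ^ k / ((k : ℂ) + n) ^ p =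
        ∑ k ∈ Finset.range M, y ^ k * ((1 / ((k : ℝ) + n) ^ p : ℝ) : ℂ) :=
      Finset.sum_congr rfl fun k _ => by push_cast; ring
    rw [e, div_div, le_div_iff₀ (by positivity)]
    have : n * (‖1 - y‖ * ‖∑ k ∈ Finset.range M, y ^ k * ((1 / ((k : ℝ) + n) ^ p : ℝ) : ℂ)‖) ≤
        n * (2 * (1 / n)) := mul_le_mul_of_nonneg_left (by linarith) (by positivity)
    have h3 : (n : ℝ) * (2 * (1 / n)) = 2 := by field_simp
    linarith

theorem zetaFin_add (n M p : ℕ) (y : ℂ) : zetaFin (n + M) p y =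
    zetaFin n p y + y ^ (n + 1) * ∑ k ∈ Finset.range M, y ^ k / ((k : ℂ) + (n + 1 : ℕ)) ^ p := by
  induction M with
  | zero => simp
  | succ M ih =>
    rw [← add_assoc, zetaFin, Finset.sum_Icc_succ_top (by omega), ← zetaFin, ih,
      Finset.sum_range_succ]
    push_cast
    rw [show (n : ℂ) + M + 1 = M + (n + 1) by ring]
    ring

theorem tendsto_zetaFin {p : ℕ} (hp : 1 ≤ p) {y : ℂ} (hy : ‖y‖ = 1) (hpy : (p, y) ≠ (1, 1)) :
    Tendsto (fun n => zetaFin n p y) atTop (𝓝 (polylog p y)) := by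
  obtain ⟨C, hC0, hC⟩ := exists_norm_tail_le hp hy hpy
  refine CauchySeq.tendsto_limUnder (cauchySeq_of_le_tendsto_0' (fun n => C / (n + 1 : ℕ)) ?_ ?_)
  · intro n m hnm
    obtain ⟨M, rfl⟩ := Nat.exists_eq_add_of_le hnm
    rw [dist_comm, dist_eq_norm, zetaFin_add, add_sub_cancel_left, norm_mul, norm_pow, hy, one_pow,
      one_mul]
    exact hC (n + 1) (by omega) M
  · exact (tendsto_const_div_atTop_nhds_zero_nat C).comp (tendsto_add_atTop_nat 1)

theorem tendsto_tail {p : ℕ} (hp : 1 ≤ p) {y : ℂ} (hy : ‖y‖ = 1) (hpy : (p, y) ≠ (1, 1)) (n : ℕ) :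
    Tendsto (fun M => ∑ k ∈ Finset.range M, y ^ k / ((k : ℂ) + (n + 1 : ℕ)) ^ p) atTop
      (𝓝 ((y ^ (n + 1))⁻¹ * (polylog p y - zetaFin n p y))) := by
  have hy0 : y ≠ 0 := fun h => by simp [h] at hy
  have h := (((tendsto_zetaFin hp hy hpy).comp (tendsto_add_atTop_nat n)).sub_const
    (zetaFin n p y)).const_mul (y ^ (n + 1))⁻¹
  refine h.congr fun M => ?_
  have := pow_ne_zero (n + 1) hy0
  simp only [Function.comp_apply]
  rw [add_comm M n, zetaFin_add, add_sub_cancel_left, inv_mul_cancel_left₀ this]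

theorem exists_norm_polylog_sub_le {p : ℕ} (hp : 1 ≤ p) {y : ℂ} (hy : ‖y‖ = 1)
    (hpy : (p, y) ≠ (1, 1)) :
    ∃ C : ℝ, 0 ≤ C ∧ ∀ n : ℕ, ‖polylog p y - zetaFin n p y‖ ≤ C / (n + 1 : ℕ) := by
  obtain ⟨C, hC0, hC⟩ := exists_norm_tail_le hp hy hpy
  refine ⟨C, hC0, fun n => ?_⟩
  have := le_of_tendsto (tendsto_tail hp hy hpy n).norm
    (Eventually.of_forall fun M => hC (n + 1) (by omega) M)
  rwa [norm_mul, norm_inv, norm_pow, hy, one_pow, inv_one, one_mul] at this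

/-- The difference consists of a fixed number `2n` of terms, each `O(N⁻¹)`. This is the case `x =
1`, `k = 0`, where the two harmonic sums diverge separately. -/
theorem tendsto_zetaFin_one_sub (n : ℕ) :
    Tendsto (fun N => zetaFin (N - n) 1 1 - zetaFin (N + n) 1 1) atTop (𝓝 0) := by
  rw [← tendsto_add_atTop_iff_nat n]
  refine squeeze_zero_norm (a := fun N : ℕ => (2 * n : ℝ) * (1 / ((N : ℝ) + 1))) ?_ ?_
  · intro N
    rw [Nat.add_sub_cancel, show N + n + n = N + 2 * n by ring, zetaFin_add, sub_add_cancel_left,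
      norm_neg, one_pow, one_mul]
    refine (norm_sum_le _ _).trans ?_
    have : ∀ k ∈ Finset.range (2 * n), ‖(1 : ℂ) ^ k / ((k : ℂ) + (N + 1 : ℕ)) ^ 1‖ ≤
        1 / ((N : ℝ) + 1) := by
      intro k _
      rw [one_pow, pow_one, norm_div, norm_one,
        show (k : ℂ) + (N + 1 : ℕ) = ((k + (N + 1) : ℕ) : ℂ) by push_cast; rfl,
        Complex.norm_natCast]
      push_cast
      exact one_div_le_one_div_of_le (by positivity) (by linarith [(Nat.cast_nonneg k : (0:ℝ) ≤ k)])
    refine (Finset.sum_le_card_nsmul _ _ _ this).trans_eq ?_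
    simp
  · simpa using tendsto_one_div_add_atTop_nhds_zero_nat.const_mul (2 * n : ℝ)

/-! ### Partial fractions at integers -/

theorem poleSum_Icc_zero (p : ℕ) (y : ℂ) (M : ℕ) (s : ℂ) :
    poleSum p y (Finset.Icc 0 (M : ℤ)) s =
      ∑ k ∈ Finset.range (M + 1), y ^ k / ((k : ℂ) + s) ^ p := by
  have : Finset.Icc 0 (M : ℤ) = (Finset.range (M + 1)).image fun k : ℕ => (k : ℤ) := by
    ext m
    simp only [Finset.mem_Icc, Finset.mem_image, Finset.mem_range]
    exact ⟨fun h => ⟨m.toNat, by omega, by omega⟩, by rintro ⟨k, hk, rfl⟩; omega⟩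
  rw [poleSum, this, Finset.sum_image fun a _ b _ h => by exact_mod_cast h]
  exact Finset.sum_congr rfl fun k _ => by rw [add_comm]; simp

/-- Reversing the order of summation shows that, at a distance `m` beyond the last pole, the
truncated sum is a unimodular multiple of an initial piece of a tail for `y⁻¹`; the uniform tail
bound then applies. -/
theorem poleSum_Icc_neg (p : ℕ) {y : ℂ} (hy : y ≠ 0) (M m : ℕ) :
    poleSum p y (Finset.Icc 0 (M : ℤ)) (-((m + M : ℕ) : ℂ)) =
      (-1) ^ p * y ^ M * ∑ k ∈ Finset.range (M + 1), y⁻¹ ^ k / ((k : ℂ) + m) ^ p := by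
  rw [poleSum_Icc_zero, ← Finset.sum_range_reflect, Finset.mul_sum]
  refine Finset.sum_congr rfl fun k hk => ?_
  have hk' : k ≤ M := Nat.lt_succ_iff.mp (Finset.mem_range.mp hk)
  rw [show M + 1 - 1 - k = M - k by omega, Nat.cast_sub hk']
  have e : (M : ℂ) - k + -((m + M : ℕ) : ℂ) = (-1) * (k + m) := by push_cast; ring
  have e1 : ((-1 : ℂ) ^ p) * (-1) ^ p = 1 := by rw [← mul_pow]; simp
  have h1 : (-1 : ℂ) ^ p ≠ 0 := by simp
  rw [e, mul_pow, pow_sub₀ y hy hk', inv_pow, div_mul_eq_div_div, div_eq_mul_inv _ ((-1 : ℂ) ^ p),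
    inv_eq_of_mul_eq_one_left e1]
  ring

theorem poleSum_Icc_erase (p : ℕ) (y : ℂ) (a b : ℕ) :
    poleSum p y ((Finset.Icc (-a : ℤ) b).erase 0) 0 =
      zetaFin b p y + (-1) ^ p * zetaFin a p y⁻¹ := by
  have : (Finset.Icc (-a : ℤ) b).erase 0 = (Finset.Icc 1 b).image (fun k : ℕ => (k : ℤ)) ∪
      (Finset.Icc 1 a).image (fun k : ℕ => (-k : ℤ)) := by
    ext m
    simp only [Finset.mem_erase, Finset.mem_Icc, Finset.mem_union, Finset.mem_image]
    constructor
    · intro h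
      rcases lt_or_gt_of_ne h.1 with h1 | h1
      · exact Or.inr ⟨(-m).toNat, by omega, by omega⟩
      · exact Or.inl ⟨m.toNat, by omega, by omega⟩
    · rintro (⟨k, hk, rfl⟩ | ⟨k, hk, rfl⟩) <;> omega
  rw [poleSum, this, Finset.sum_union, Finset.sum_image fun a _ b _ h => by exact_mod_cast h,
    Finset.sum_image fun a _ b _ h => by exact_mod_cast neg_injective h, zetaFin, zetaFin,
    Finset.mul_sum]
  · congr 1
    · exact Finset.sum_congr rfl fun k _ => by simp
    · refine Finset.sum_congr rfl fun k _ => ?_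
      have e1 : ((-1 : ℂ) ^ p) * (-1) ^ p = 1 := by rw [← mul_pow]; simp
      rw [zpow_neg, zpow_natCast, inv_pow, zero_add, Int.cast_neg, Int.cast_natCast,
        neg_pow (k : ℂ), div_mul_eq_div_div, div_eq_mul_inv _ ((-1 : ℂ) ^ p),
        inv_eq_of_mul_eq_one_left e1]
      ring
  · rw [Finset.disjoint_left]
    intro m hm hm'
    obtain ⟨k, hk, rfl⟩ := Finset.mem_image.mp hm
    obtain ⟨j, hj, h⟩ := Finset.mem_image.mp hm'
    simp only [Finset.mem_Icc] at hk hj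
    omega

theorem image_sub_erase_Icc (a b n : ℤ) :
    ((Finset.Icc a b).erase n).image (· - n) = (Finset.Icc (a - n) (b - n)).erase 0 := by
  ext m
  simp only [Finset.mem_image, Finset.mem_erase, Finset.mem_Icc]
  exact ⟨by rintro ⟨k, hk, rfl⟩; omega, fun h => ⟨m + n, by omega, by omega⟩⟩

theorem regCoeff_Icc_zero (p : ℕ) (y : ℂ) {n M : ℕ} (h : n ≤ M) (k : ℕ) :
    regCoeff p y (Finset.Icc 0 (M : ℤ)) n k = ((k + p - 1).choose (p - 1) : ℂ) * (-1) ^ k *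
      (zetaFin (M - n) (k + p) y + (-1) ^ (k + p) * zetaFin n (k + p) y⁻¹) := by
  rw [regCoeff, image_sub_erase_Icc, ← poleSum_Icc_erase, zero_sub, Nat.cast_sub h]

theorem regCoeff_Icc_neg (x : ℂ) {n N : ℕ} (h : n ≤ N) (k : ℕ) :
    regCoeff 1 x (Finset.Icc (-N : ℤ) N) n k =
      (-1) ^ k * zetaFin (N - n) (k + 1) x - zetaFin (N + n) (k + 1) x⁻¹ := by
  have e1 : ((-1 : ℂ) ^ k) * (-1) ^ k = 1 := by rw [← mul_pow]; simp
  rw [regCoeff, image_sub_erase_Icc, ← Nat.cast_sub h,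
    show (-N - n : ℤ) = -((N + n : ℕ) : ℤ) by push_cast; ring, poleSum_Icc_erase, Nat.sub_self,
    Nat.choose_zero_right, Nat.cast_one, one_mul, pow_succ]
  linear_combination -(zetaFin (N + n) (k + 1) x⁻¹) * e1

/-- Seen from the pole `-n`, the window `[-N, N]` becomes `[-N-n, N-n]`; the fixed shift `n` has no
influence on the limit, even in the divergent case. -/
theorem tendsto_regCoeff_one {x : ℂ} (hx : ‖x‖ = 1) (n k : ℕ) :
    Tendsto (fun N : ℕ => regCoeff 1 x (Finset.Icc (-N : ℤ) N) n k) atTop (𝓝 (trigCoeff k x)) := by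
  have h : Tendsto (fun N : ℕ =>
      (-1) ^ k * zetaFin (N - n) (k + 1) x - zetaFin (N + n) (k + 1) x⁻¹) atTop
      (𝓝 (trigCoeff k x)) := by
    by_cases hkx : (k + 1, x) = (1, 1)
    · obtain ⟨hk, rfl⟩ := Prod.mk.inj hkx
      obtain rfl : k = 0 := by omega
      rw [trigCoeff_zero_one]
      simpa using tendsto_zetaFin_one_sub n
    · have hkx' : (k + 1, x⁻¹) ≠ (1, 1) := fun h => hkx (by
        obtain ⟨h1, h2⟩ := Prod.mk.inj h
        rw [h1, inv_eq_one.mp h2])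
      exact (((tendsto_zetaFin (by omega) hx hkx).comp (tendsto_sub_atTop_nat n)).const_mul _).sub
        ((tendsto_zetaFin (by omega) (by simpa using hx) hkx').comp (tendsto_add_atTop_nat n))
  exact h.congr' ((eventually_ge_atTop n).mono fun N hN => (regCoeff_Icc_neg x hN k).symm)

/-! ### Decay of rational functions -/

theorem tendsto_neg_natCast_cobounded :
    Tendsto (fun n : ℕ => (-(n : ℂ))) atTop (Bornology.cobounded ℂ) :=
  tendsto_norm_atTop_iff_cobounded.mp (by simpa using tendsto_natCast_atTop_atTop)

theorem isBigO_inv_sq_inv :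
    (fun s : ℂ => (s ^ 2)⁻¹) =O[Bornology.cobounded ℂ] fun s : ℂ => s⁻¹ := by
  refine IsBigO.of_bound 1 ?_
  filter_upwards [eventually_cobounded_le_norm (1 : ℝ)] with s hs
  rw [norm_inv, norm_inv, norm_pow, one_mul]
  exact inv_anti₀ (by linarith) (le_self_pow₀ hs (by norm_num))

/-- Cauchy's estimate on the disc of radius `‖s‖ / 2` about `s`, which avoids the finitely many
poles once `‖s‖` is large: each derivative gains a factor `s⁻¹`. -/
theorem taylorCoeff_isBigO {r : RatFunc ℂ} {a : ℕ}
    (hr : ratVal r =O[Bornology.cobounded ℂ] fun s : ℂ => (s ^ a)⁻¹) (j : ℕ) :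
    taylorCoeff (ratVal r) j =O[Bornology.cobounded ℂ] fun s : ℂ => (s ^ (a + j))⁻¹ := by
  obtain ⟨C, hC⟩ := hr.bound
  have h1 : ∀ᶠ s in Bornology.cobounded ℂ, ‖ratVal r s‖ ≤ C * ‖(s ^ a)⁻¹‖ ∧ s ∉ poles r :=
    hC.and (Bornology.isBounded_def.mp (poles r).finite_toSet.isBounded)
  obtain ⟨R₀, -, hR₀⟩ := (hasBasis_cobounded_norm (E := ℂ)).eventually_iff.mp h1
  refine IsBigO.of_bound (|C| * 2 ^ (a + j)) ?_
  filter_upwards [eventually_cobounded_le_norm (max (2 * R₀) 1)] with s hs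
  have hs1 : 2 * R₀ ≤ ‖s‖ := (le_max_left _ _).trans hs
  have hs2 : 1 ≤ ‖s‖ := (le_max_right _ _).trans hs
  have hpos : 0 < ‖s‖ / 2 := by linarith
  have hball : ∀ z ∈ Metric.closedBall s (‖s‖ / 2), ‖s‖ / 2 ≤ ‖z‖ := fun z hz => by
    have := norm_sub_norm_le s z
    rw [mem_closedBall_iff_norm'] at hz
    linarith
  have hd : DifferentiableOn ℂ (ratVal r) (Metric.closedBall s (‖s‖ / 2)) := fun z hz =>
    (analyticAt_ratVal (hR₀ (show R₀ ≤ ‖z‖ by linarith [hball z hz])).2).differentiableAt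
      |>.differentiableWithinAt
  have hb := Complex.norm_iteratedDeriv_le_of_forall_mem_sphere_norm_le j hpos
    ((hd.mono Metric.closure_ball_subset_closedBall).diffContOnCl)
    (C := |C| / (‖s‖ / 2) ^ a) fun z hz => by
      have hz' := hball z (Metric.sphere_subset_closedBall hz)
      refine (hR₀ (show R₀ ≤ ‖z‖ by linarith)).1.trans ?_
      rw [norm_inv, norm_pow, ← div_eq_mul_inv]
      exact div_le_div₀ (abs_nonneg C) (le_abs_self C) (by positivity)
        (pow_le_pow_left₀ hpos.le hz' a)
  rw [taylorCoeff, norm_div, Complex.norm_natCast, div_le_iff₀ (by positivity)]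
  refine hb.trans_eq ?_
  rw [norm_inv, norm_pow, div_pow, div_pow, pow_add, pow_add]
  field_simp

theorem exists_norm_le_div {u : ℕ → ℂ} (hu : u =O[atTop] fun n : ℕ => ((n : ℂ))⁻¹) :
    ∃ C : ℝ, 0 ≤ C ∧ ∀ n : ℕ, 1 ≤ n → ‖u n‖ ≤ C / n := by
  obtain ⟨C, hC, h⟩ := bound_of_isBigO_nat_atTop hu
  refine ⟨C, hC.le, fun n hn => ?_⟩
  have := h (x := n) (inv_ne_zero (by exact_mod_cast (by omega : n ≠ 0)))
  simpa [div_eq_mul_inv] using this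

theorem summable_of_isBigO_sq {u : ℕ → ℂ} (hu : u =O[atTop] fun n : ℕ => ((n : ℂ) ^ 2)⁻¹) :
    Summable u := by
  refine summable_of_isBigO_nat (Real.summable_one_div_nat_pow.mpr one_lt_two)
    (hu.trans (IsBigO.of_bound 1 ?_))
  filter_upwards with n
  simp

theorem isBigO_inv_pow_inv_sq {k : ℕ} (hk : 2 ≤ k) :
    (fun n : ℕ => ((-(n : ℂ)) ^ k)⁻¹) =O[atTop] fun n : ℕ => ((n : ℂ) ^ 2)⁻¹ := by
  refine IsBigO.of_bound 1 ?_
  filter_upwards [eventually_ge_atTop 1] with n hn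
  have hn' : (1 : ℝ) ≤ n := by exact_mod_cast hn
  rw [norm_inv, norm_inv, norm_pow, norm_pow, norm_neg, Complex.norm_natCast, one_mul]
  exact inv_anti₀ (by positivity) (pow_le_pow_right₀ hn' hk)

theorem isBigO_pow_mul {z : ℂ} (hz : ‖z‖ = 1) {u : ℕ → ℂ} {v : ℕ → ℂ} (hu : u =O[atTop] v) :
    (fun n => z ^ n * u n) =O[atTop] v := by
  refine IsBigO.trans (IsBigO.of_bound 1 ?_) hu
  filter_upwards with n
  simp [hz]

/-! ### Convergence of the series -/

theorem sum_Icc_one (u : ℕ → ℂ) (N : ℕ) :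
    ∑ n ∈ Finset.Icc 1 N, u n = ∑ k ∈ Finset.range N, u (k + 1) := by
  induction N with
  | zero => simp
  | succ N ih => rw [Finset.sum_Icc_succ_top (by omega), ih, Finset.sum_range_succ]

theorem seriesTo_iff {u : ℕ → ℂ} {S : ℂ} :
    SeriesTo u S ↔ Tendsto (fun N => ∑ k ∈ Finset.range N, u (k + 1)) atTop (𝓝 S) := by
  simp only [SeriesTo, sum_Icc_one]

theorem seriesTo_tsum {u : ℕ → ℂ} (hu : Summable fun k => u (k + 1)) :
    SeriesTo u (∑' k, u (k + 1)) :=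
  seriesTo_iff.mpr hu.hasSum.tendsto_sum_nat

theorem exists_seriesTo_of_summable {u : ℕ → ℂ} (hu : Summable u) : ∃ S, SeriesTo u S :=
  ⟨_, seriesTo_tsum ((summable_nat_add_iff 1).mpr hu)⟩

/-- Summation by parts: `(1 - z)` times the partial sum is a boundary term plus an absolutely
convergent sum over the increments of `a`. -/
theorem exists_tendsto_sum_pow_mul {z : ℂ} (hz : ‖z‖ = 1) (hz1 : z ≠ 1) {a : ℕ → ℂ}
    (ha : Tendsto a atTop (𝓝 0)) (hs : Summable fun n => a (n + 1) - a n) :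
    ∃ S, Tendsto (fun N => ∑ k ∈ Finset.range N, z ^ k * a k) atTop (𝓝 S) := by
  have h1 : ∀ N, (1 - z) * ∑ k ∈ Finset.range N, z ^ k * a k =
      a 0 - z ^ N * a N + ∑ k ∈ Finset.range N, z ^ (k + 1) * (a (k + 1) - a k) := by
    intro N
    induction N with
    | zero => simp
    | succ N ih => rw [Finset.sum_range_succ, mul_add, ih, Finset.sum_range_succ]; ring
  have h2 : Summable fun k => z ^ (k + 1) * (a (k + 1) - a k) :=
    Summable.of_norm (by simpa [hz] using hs.norm)
  have h3 : Tendsto (fun N => z ^ N * a N) atTop (𝓝 0) := by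
    rw [tendsto_zero_iff_norm_tendsto_zero] at ha ⊢
    simpa [hz] using ha
  have hz' : 1 - z ≠ 0 := sub_ne_zero.mpr hz1.symm
  refine ⟨_, (((tendsto_const_nhds (x := a 0)).sub h3).add
    h2.hasSum.tendsto_sum_nat |>.const_mul (1 - z)⁻¹).congr fun N => ?_⟩
  rw [← h1, inv_mul_cancel_left₀ hz']

/-- The mean value inequality on the unit disc about `-(n+1)`, where the derivative is `O(n⁻²)`,
bounds the increments. -/
theorem summable_ratVal_diff {r : RatFunc ℂ}
    (hr : ratVal r =O[Bornology.cobounded ℂ] fun s : ℂ => s⁻¹) :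
    Summable fun n : ℕ => ratVal r (-((n + 1 : ℕ) : ℂ)) - ratVal r (-(n : ℂ)) := by
  have h1 := taylorCoeff_isBigO (a := 1) (by simpa using hr) 1
  obtain ⟨C, hC⟩ := h1.bound
  have h2 : ∀ᶠ s in Bornology.cobounded ℂ,
      ‖taylorCoeff (ratVal r) 1 s‖ ≤ C * ‖(s ^ (1 + 1))⁻¹‖ ∧ s ∉ poles r :=
    hC.and (Bornology.isBounded_def.mp (poles r).finite_toSet.isBounded)
  obtain ⟨R₀, -, hR₀⟩ := (hasBasis_cobounded_norm (E := ℂ)).eventually_iff.mp h2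
  refine summable_of_isBigO_sq (IsBigO.of_bound |C| ?_)
  filter_upwards [eventually_ge_atTop (Nat.ceil R₀ + 1)] with n hn
  have hn1 : R₀ ≤ n := (Nat.le_ceil R₀).trans (by exact_mod_cast (by omega : Nat.ceil R₀ ≤ n))
  have hn0 : (0 : ℝ) < n := by exact_mod_cast (by omega : 0 < n)
  have hball : ∀ z ∈ Metric.closedBall (-((n + 1 : ℕ) : ℂ)) 1, (n : ℝ) ≤ ‖z‖ := fun z hz => by
    have := norm_sub_norm_le (-((n + 1 : ℕ) : ℂ)) z
    rw [mem_closedBall_iff_norm'] at hz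
    rw [norm_neg, Complex.norm_natCast] at this
    push_cast at this hz
    linarith
  have h := (convex_closedBall (-((n + 1 : ℕ) : ℂ)) 1).norm_image_sub_le_of_norm_deriv_le
    (𝕜 := ℂ) (f := ratVal r) (C := |C| * ((n : ℝ) ^ 2)⁻¹) (x := -(n : ℂ)) (y := -((n + 1 : ℕ) : ℂ))
    (fun z hz => (analyticAt_ratVal (hR₀ (hn1.trans (hball z hz))).2).differentiableAt)
    (fun z hz => ?_) (by simp [dist_eq_norm]) (by simp)
  · refine h.trans_eq ?_
    have e : -((n + 1 : ℕ) : ℂ) - -(n : ℂ) = -1 := by push_cast; ring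
    rw [e]; simp
  · have := (hR₀ (hn1.trans (hball z hz))).1
    rw [taylorCoeff, iteratedDeriv_one, Nat.factorial_one, Nat.cast_one, div_one] at this
    refine this.trans ?_
    rw [norm_inv, norm_pow]
    exact mul_le_mul (le_abs_self C) (inv_anti₀ (by positivity)
      (pow_le_pow_left₀ hn0.le (hball z hz) 2)) (by positivity) (abs_nonneg C)

/-- The decay hypothesis: `r = O(s⁻²)`, or `r = O(s⁻¹)` and `z ≠ 1`. -/
def Decay (z : ℂ) (r : RatFunc ℂ) : Prop :=
  ratVal r =O[Bornology.cobounded ℂ] (fun s : ℂ => (s ^ 2)⁻¹) ∨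
    (z ≠ 1 ∧ ratVal r =O[Bornology.cobounded ℂ] (fun s : ℂ => s⁻¹))

theorem Decay.isBigO {z : ℂ} {r : RatFunc ℂ} (h : Decay z r) :
    ratVal r =O[Bornology.cobounded ℂ] fun s : ℂ => s⁻¹ := by
  rcases h with h | h
  · exact h.trans isBigO_inv_sq_inv
  · exact h.2

theorem isBigO_ratVal_neg {r : RatFunc ℂ}
    (hr : ratVal r =O[Bornology.cobounded ℂ] fun s : ℂ => s⁻¹) :
    (fun n : ℕ => ratVal r (-(n : ℂ))) =O[atTop] fun n : ℕ => ((n : ℂ))⁻¹ := by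
  refine (hr.comp_tendsto tendsto_neg_natCast_cobounded).trans (IsBigO.of_bound 1 ?_)
  filter_upwards with n
  simp

/-- Convergence is absolute except when `j = 0` and `r` is only `O(s⁻¹)`; there `z ≠ 1` is needed
for summation by parts. -/
theorem exists_seriesTo_taylorCoeff {z : ℂ} (hz : ‖z‖ = 1) {r : RatFunc ℂ} (h : Decay z r) (j : ℕ) :
    ∃ S, SeriesTo (fun n => z ^ n * taylorCoeff (ratVal r) j (-(n : ℂ))) S := by
  have key : ∀ a, 2 ≤ a + j → ratVal r =O[Bornology.cobounded ℂ] (fun s : ℂ => (s ^ a)⁻¹) →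
      ∃ S, SeriesTo (fun n => z ^ n * taylorCoeff (ratVal r) j (-(n : ℂ))) S := fun a ha hr =>
    exists_seriesTo_of_summable (summable_of_isBigO_sq (isBigO_pow_mul hz
      (((taylorCoeff_isBigO hr j).comp_tendsto tendsto_neg_natCast_cobounded).trans
        (isBigO_inv_pow_inv_sq ha))))
  rcases h with h | ⟨hz1, h⟩
  · exact key 2 (by omega) h
  · rcases Nat.eq_zero_or_pos j with rfl | hj
    · have h0 : Tendsto (fun n : ℕ => ratVal r (-(n : ℂ))) atTop (𝓝 0) := by
        refine (h.trans_tendsto tendsto_inv₀_cobounded).comp tendsto_neg_natCast_cobounded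
      obtain ⟨S, hS⟩ := exists_tendsto_sum_pow_mul hz hz1 h0 (summable_ratVal_diff h)
      -- The summation by parts starts at `n = 0`; that term, possibly a default value at a pole, is
      -- subtracted again.
      refine ⟨S - ratVal r 0, seriesTo_iff.mpr ?_⟩
      refine ((hS.comp (tendsto_add_atTop_nat 1)).sub_const (ratVal r 0)).congr fun N => ?_
      simp [Finset.sum_range_succ', taylorCoeff]
    · exact key 1 (by omega) (by simpa using h)

theorem SeriesTo.const_mul {u : ℕ → ℂ} {S : ℂ} (h : SeriesTo u S) (c : ℂ) :
    SeriesTo (fun n => c * u n) (c * S) := by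
  simpa [SeriesTo, Finset.mul_sum] using Tendsto.const_mul c h

theorem SeriesTo.sub {u v : ℕ → ℂ} {S T : ℂ} (h : SeriesTo u S) (h' : SeriesTo v T) :
    SeriesTo (fun n => u n - v n) (S - T) := by
  simpa [SeriesTo] using Tendsto.sub h h'

theorem exists_seriesTo_trigCoeff {z : ℂ} (hz : ‖z‖ = 1) {r : RatFunc ℂ} (h : Decay z r) (p : ℕ)
    (x : ℂ) : ∃ S, SeriesTo (fun n => ∑ k ∈ Finset.range p,
      trigCoeff k x * (z ^ n * taylorCoeff (ratVal r) (p - k - 1) (-(n : ℂ)))) S := by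
  choose S hS using fun j => exists_seriesTo_taylorCoeff hz h j
  refine ⟨∑ k ∈ Finset.range p, trigCoeff k x * S (p - k - 1), ?_⟩
  have := tendsto_finsetSum (Finset.range p) fun k _ => (hS (p - k - 1)).const_mul (trigCoeff k x)
  exact this.congr fun N => Finset.sum_comm

theorem isBigO_polylog_sub {p : ℕ} (hp : 1 ≤ p) {y : ℂ} (hy : ‖y‖ = 1) (hpy : (p, y) ≠ (1, 1)) :
    (fun n => polylog p y - zetaFin n p y) =O[atTop] fun n : ℕ => ((n : ℂ))⁻¹ := by
  obtain ⟨C, hC0, hC⟩ := exists_norm_polylog_sub_le hp hy hpy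
  refine IsBigO.of_bound C ?_
  filter_upwards [eventually_ge_atTop 1] with n hn
  refine (hC n).trans ?_
  rw [norm_inv, Complex.norm_natCast, ← div_eq_mul_inv]
  exact div_le_div_of_nonneg_left hC0 (by exact_mod_cast hn) (by exact_mod_cast n.le_succ)

/-- Writing `ζ_n(p; y⁻¹)` as its limit minus a tail splits the series into a multiple of the `j = 0`
series and one with terms `O(n⁻²)`. -/
theorem exists_seriesTo_zetaFin {p : ℕ} (hp : 1 ≤ p) {y z : ℂ} (hy : ‖y‖ = 1)
    (hpy : (p, y) ≠ (1, 1)) (hz : ‖z‖ = 1) {r : RatFunc ℂ} (h : Decay z r) :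
    ∃ S, SeriesTo (fun n => (polylog p y + (-1) ^ p * zetaFin n p y⁻¹) * z ^ n
        * ratVal r (-(n : ℂ))) S := by
  have hpy' : (p, y⁻¹) ≠ (1, 1) := fun h => hpy (by
    obtain ⟨h1, h2⟩ := Prod.mk.inj h
    rw [h1, inv_eq_one.mp h2])
  obtain ⟨S, hS⟩ := exists_seriesTo_taylorCoeff hz h 0
  have h1 : Summable fun n : ℕ => z ^ n * ((polylog p y⁻¹ - zetaFin n p y⁻¹) *
      ratVal r (-(n : ℂ))) := by
    refine summable_of_isBigO_sq (isBigO_pow_mul hz ?_)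
    simpa [sq] using! (isBigO_polylog_sub hp (by simpa using hy) hpy').mul
      (isBigO_ratVal_neg h.isBigO)
  obtain ⟨T, hT⟩ := exists_seriesTo_of_summable h1
  refine ⟨_, ((hS.const_mul (polylog p y + (-1) ^ p * polylog p y⁻¹)).sub
    (hT.const_mul ((-1) ^ p))).congr fun N => Finset.sum_congr rfl fun n _ => ?_⟩
  simp only [taylorCoeff, iteratedDeriv_zero, Nat.factorial_zero, Nat.cast_one, div_one]
  ring

/-! ### Locally uniform convergence of the kernel -/

open Complex (integerComplement)

theorem isOpen_integerComplement : IsOpen integerComplement := Complex.isOpen_compl_range_intCast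

/-- The partial sums defining `genDigamma`. -/
def digammaSum (x : ℂ) (N : ℕ) (s : ℂ) : ℂ :=
  ∑ k ∈ Finset.range N, (x ^ k / ((k : ℂ) + s) - if x = 1 then 1 / ((k : ℂ) + 1) else 0)

theorem differentiableOn_digammaSum (x : ℂ) (N : ℕ) :
    DifferentiableOn ℂ (digammaSum x N) integerComplement := by
  refine DifferentiableOn.fun_sum fun k _ => ?_
  have : ∀ s ∈ integerComplement, (k : ℂ) + s ≠ 0 := fun s hs => by
    have := Complex.integerComplement_add_ne_zero hs k
    rwa [add_comm, Int.cast_natCast] at this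
  exact ((differentiableOn_const _).div (by fun_prop) this).sub (differentiableOn_const _)

theorem exists_tendsto_digammaSum_one {x : ℂ} (hx : ‖x‖ = 1) :
    ∃ c, Tendsto (fun N => digammaSum x N 1) atTop (𝓝 c) := by
  by_cases h : x = 1
  · exact ⟨0, tendsto_const_nhds.congr fun N => by simp [digammaSum, h]⟩
  · have := tendsto_tail le_rfl hx (fun hh => h (Prod.mk.inj hh).2) 0
    exact ⟨_, this.congr fun N => by simp [digammaSum, h]⟩

/-- Comparison with `s = 1`: the regularizing terms cancel in the difference, whose terms are
`O(k⁻²)` uniformly on `K`, so the Weierstrass M-test applies even where the series itself converges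
only conditionally. -/
theorem tendstoUniformlyOn_digammaSum {x : ℂ} (hx : ‖x‖ = 1) {K : Set ℂ} (hK : IsCompact K)
    (hKU : K ⊆ integerComplement) :
    TendstoUniformlyOn (digammaSum x) (fun s => genDigamma s x) atTop K := by
  obtain ⟨c, hc⟩ := exists_tendsto_digammaSum_one hx
  obtain ⟨B, hB⟩ := hK.isBounded.exists_norm_le
  have hsplit : ∀ N, ∀ s ∈ K, digammaSum x N 1 + ∑ k ∈ Finset.range N,
      x ^ k * ((1 - s) / (((k : ℂ) + s) * (k + 1))) = digammaSum x N s := by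
    intro N s hs
    rw [digammaSum, digammaSum, ← Finset.sum_add_distrib]
    refine Finset.sum_congr rfl fun k _ => ?_
    have h1 : (k : ℂ) + s ≠ 0 := by
      have := Complex.integerComplement_add_ne_zero (hKU hs) k
      rwa [add_comm, Int.cast_natCast] at this
    have h2 : (k : ℂ) + 1 ≠ 0 := by exact_mod_cast k.succ_ne_zero
    field_simp
    ring
  have hsum : Summable fun k : ℕ => (2 * (1 + B)) * (1 / (k : ℝ) ^ 2) :=
    (Real.summable_one_div_nat_pow.mpr one_lt_two).mul_left _
  have hunif := tendstoUniformlyOn_tsum_nat_eventually hsum (s := K)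
    (f := fun k s => x ^ k * ((1 - s) / (((k : ℂ) + s) * (k + 1)))) (by
      -- From `k ≥ 2B` follows `‖k + s‖ ≥ k / 2` on `K`.
      filter_upwards [eventually_ge_atTop (Nat.ceil (2 * B) + 1)] with k hk s hs
      have hk1 : 2 * B ≤ k := (Nat.le_ceil _).trans (by exact_mod_cast (by omega))
      have hk0 : (0 : ℝ) < k := by exact_mod_cast (by omega : 0 < k)
      have hsB := hB s hs
      have h1 : (k : ℝ) / 2 ≤ ‖(k : ℂ) + s‖ := by
        have := norm_sub_le ((k : ℂ) + s) s
        rw [add_sub_cancel_right, Complex.norm_natCast] at this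
        linarith
      have h2 : (k : ℝ) ≤ ‖(k : ℂ) + 1‖ := by
        rw [show (k : ℂ) + 1 = ((k + 1 : ℕ) : ℂ) by push_cast; rfl, Complex.norm_natCast]
        exact_mod_cast k.le_succ
      have h3 : ‖1 - s‖ ≤ 1 + B := (norm_sub_le _ _).trans (by rw [norm_one]; linarith)
      rw [norm_mul, norm_pow, hx, one_pow, one_mul, norm_div, norm_mul]
      calc ‖1 - s‖ / (‖(k : ℂ) + s‖ * ‖(k : ℂ) + 1‖) ≤ (1 + B) / ((k : ℝ) / 2 * k) :=
            div_le_div₀ ((norm_nonneg _).trans h3) h3 (by positivity)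
              (mul_le_mul h1 h2 hk0.le (norm_nonneg _))
        _ = (2 * (1 + B)) * (1 / (k : ℝ) ^ 2) := by field_simp)
  have hconst : TendstoUniformlyOn (fun N (_ : ℂ) => digammaSum x N 1) (fun _ => c) atTop K :=
    hc.tendstoUniformlyOn_const K
  have hadd := (hconst.add hunif).congr (Eventually.of_forall fun N s hs => hsplit N s hs)
  exact hadd.congr_right fun s hs => (hadd.tendsto_at hs).limUnder_eq.symm

theorem tendstoLocallyUniformlyOn_digammaSum {x : ℂ} (hx : ‖x‖ = 1) :
    TendstoLocallyUniformlyOn (digammaSum x) (fun s => genDigamma s x) atTop integerComplement :=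
  (tendstoLocallyUniformlyOn_iff_forall_isCompact isOpen_integerComplement).mpr
    fun _ hKU hK => tendstoUniformlyOn_digammaSum hx hK hKU

theorem differentiableOn_iteratedDeriv {f : ℂ → ℂ} {U : Set ℂ} (hU : IsOpen U)
    (hf : DifferentiableOn ℂ f U) (j : ℕ) : DifferentiableOn ℂ (iteratedDeriv j f) U := by
  induction j with
  | zero => simpa using hf
  | succ j ih => rw [iteratedDeriv_succ]; exact ih.deriv hU

theorem tendstoLocallyUniformlyOn_iteratedDeriv {F : ℕ → ℂ → ℂ} {f : ℂ → ℂ} {U : Set ℂ}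
    (hU : IsOpen U) (hF : ∀ n, DifferentiableOn ℂ (F n) U)
    (h : TendstoLocallyUniformlyOn F f atTop U) (j : ℕ) :
    TendstoLocallyUniformlyOn (fun n => iteratedDeriv j (F n)) (iteratedDeriv j f) atTop U := by
  induction j with
  | zero => simpa using h
  | succ j ih =>
    simp only [iteratedDeriv_succ]
    exact ih.deriv (Eventually.of_forall fun n => differentiableOn_iteratedDeriv hU (hF n) j) hU

theorem tendsto_taylorCoeff {F : ℕ → ℂ → ℂ} {f : ℂ → ℂ} {U : Set ℂ}
    (hU : IsOpen U) (hF : ∀ n, DifferentiableOn ℂ (F n) U)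
    (h : TendstoLocallyUniformlyOn F f atTop U) {a : ℂ} (ha : a ∈ U) (j : ℕ) :
    Tendsto (fun n => taylorCoeff (F n) j a) atTop (𝓝 (taylorCoeff f j a)) :=
  ((tendstoLocallyUniformlyOn_iteratedDeriv hU hF h j).tendsto_at ha).div_const _

theorem differentiableOn_poleSum (p : ℕ) (y : ℂ) (S : Finset ℤ) :
    DifferentiableOn ℂ (poleSum p y S) integerComplement := fun _ hs =>
  (analyticAt_poleSum fun m _ =>
    Complex.integerComplement_add_ne_zero hs m).differentiableAt.differentiableWithinAt

theorem neg_mem_integerComplement {s : ℂ} (hs : s ∈ integerComplement) :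
    -s ∈ integerComplement := fun ⟨n, hn⟩ => hs ⟨-n, by rw [Int.cast_neg, hn, neg_neg]⟩

theorem sum_Icc_neg_int (f : ℤ → ℂ) (N : ℕ) : ∑ m ∈ Finset.Icc (-N : ℤ) N, f m =
    ∑ k ∈ Finset.range (N + 1), f k + ∑ k ∈ Finset.range (N + 1), f (-k) - f 0 := by
  induction N with
  | zero => simp
  | succ N ih =>
    have e : Finset.Icc (-(N + 1 : ℕ) : ℤ) (N + 1 : ℕ) =
        insert ((N + 1 : ℕ) : ℤ) (insert (-(N + 1 : ℕ) : ℤ) (Finset.Icc (-N : ℤ) N)) := by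
      ext k; simp only [Finset.mem_Icc, Finset.mem_insert]; omega
    rw [e, Finset.sum_insert, Finset.sum_insert, ih, Finset.sum_range_succ _ (N + 1),
      Finset.sum_range_succ (fun k : ℕ => f (-k)) (N + 1)]
    · ring
    · simp
    · simp; omega

/-- The regularizing terms for `x` and `x⁻¹` cancel, and `1 / s` removes the index `0` counted
twice. -/
theorem digammaSum_sub (x : ℂ) (N : ℕ) {s : ℂ} :
    digammaSum x (N + 1) s - digammaSum x⁻¹ (N + 1) (-s) - 1 / s =
      poleSum 1 x (Finset.Icc (-N : ℤ) N) s := by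
  rw [poleSum, sum_Icc_neg_int, digammaSum, digammaSum, ← Finset.sum_sub_distrib,
    ← Finset.sum_add_distrib]
  congr 1
  · refine Finset.sum_congr rfl fun k _ => ?_
    simp only [inv_eq_one]
    have : s + ((-k : ℤ) : ℂ) = -(k + -s) := by push_cast; ring
    rw [this, add_comm (k : ℂ) s]
    simp only [pow_one, zpow_neg, zpow_natCast, inv_pow, Int.cast_natCast, div_neg]
    ring
  · simp

theorem tendstoLocallyUniformlyOn_extTrig {x : ℂ} (hx : ‖x‖ = 1) :
    TendstoLocallyUniformlyOn (fun N : ℕ => poleSum 1 x (Finset.Icc (-N : ℤ) N))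
      (fun s => extTrig s x) atTop integerComplement := by
  have shift : ∀ z : ℂ, ‖z‖ = 1 → TendstoLocallyUniformlyOn (fun N => digammaSum z (N + 1))
      (fun s => genDigamma s z) atTop integerComplement := fun z hz u hu s hs => by
    obtain ⟨t, ht, h⟩ := tendstoLocallyUniformlyOn_digammaSum hz u hu s hs
    exact ⟨t, ht, (tendsto_add_atTop_nat 1).eventually h⟩
  have h1 := shift x hx
  have h2 := (shift x⁻¹ (by simpa using hx)).comp (fun s : ℂ => -s)
    (fun s hs => neg_mem_integerComplement hs) continuous_neg.continuousOn
  have h3 : TendstoLocallyUniformlyOn (fun (_ : ℕ) (s : ℂ) => 1 / s) (fun s => 1 / s) atTop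
      integerComplement := fun u hu s hs =>
    ⟨Set.univ, univ_mem, Eventually.of_forall fun _ _ _ => refl_mem_uniformity hu⟩
  exact ((h1.sub h2).sub h3).congr fun N s _ => digammaSum_sub x N

/-- The function `φ^{(p-1)}(s; y) (-1)^{p-1} / (p-1)!`. -/
def digammaDeriv (p : ℕ) (y s : ℂ) : ℂ :=
  (-1) ^ (p - 1) * taylorCoeff (fun z => genDigamma z y) (p - 1) s

theorem taylorCoeff_digammaSum {p : ℕ} (hp : 1 ≤ p) {y : ℂ} (hpy : (p, y) ≠ (1, 1)) (M : ℕ) {s : ℂ}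
    (hs : s ∈ integerComplement) :
    (-1) ^ (p - 1) * taylorCoeff (digammaSum y (M + 1)) (p - 1) s =
      poleSum p y (Finset.Icc 0 (M : ℤ)) s := by
  have hs' : ∀ m ∈ Finset.Icc 0 (M : ℤ), s + m ≠ 0 := fun m _ =>
    Complex.integerComplement_add_ne_zero hs m
  -- The regularizing constant is killed by differentiation when `p > 1`; when `p = 1` it is zero
  -- because `y ≠ 1`.
  have hC : ∃ c, (p = 1 → c = 0) ∧
      digammaSum y (M + 1) = fun z => poleSum 1 y (Finset.Icc 0 (M : ℤ)) z - c := by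
    refine ⟨∑ k ∈ Finset.range (M + 1), if y = 1 then 1 / ((k : ℂ) + 1) else 0, ?_, ?_⟩
    · rintro rfl
      simp [show y ≠ 1 from fun h => hpy (by rw [h])]
    · ext z
      simp [digammaSum, poleSum_Icc_zero]
  obtain ⟨c, hc, e⟩ := hC
  have h1 : taylorCoeff (digammaSum y (M + 1)) (p - 1) s =
      taylorCoeff (poleSum 1 y (Finset.Icc 0 (M : ℤ))) (p - 1) s := by
    rw [e, taylorCoeff, iteratedDeriv_fun_sub (analyticAt_poleSum hs').contDiffAt contDiffAt_const,
      iteratedDeriv_const, taylorCoeff]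
    split_ifs with h
    · rw [hc (by omega), sub_zero]
    · rw [sub_zero]
  rw [h1, taylorCoeff_poleSum le_rfl hs', Nat.sub_self, Nat.choose_zero_right, Nat.cast_one,
    one_mul, ← mul_assoc, ← mul_pow, neg_one_mul, neg_neg, one_pow, one_mul, Nat.sub_add_cancel hp]

theorem tendstoLocallyUniformlyOn_digammaDeriv {p : ℕ} (hp : 1 ≤ p) {y : ℂ} (hy : ‖y‖ = 1)
    (hpy : (p, y) ≠ (1, 1)) :
    TendstoLocallyUniformlyOn (fun M : ℕ => poleSum p y (Finset.Icc 0 (M : ℤ)))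
      (digammaDeriv p y) atTop integerComplement := by
  have h1 := tendstoLocallyUniformlyOn_iteratedDeriv isOpen_integerComplement
    (differentiableOn_digammaSum y) (tendstoLocallyUniformlyOn_digammaSum hy) (p - 1)
  have h2 : TendstoLocallyUniformlyOn (fun M => iteratedDeriv (p - 1) (digammaSum y (M + 1)))
      (iteratedDeriv (p - 1) fun s => genDigamma s y) atTop integerComplement :=
    fun u hu s hs => by
      obtain ⟨t, ht, h⟩ := h1 u hu s hs
      exact ⟨t, ht, (tendsto_add_atTop_nat 1).eventually h⟩
  have h3 := (uniformContinuous_const_smul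
    ((-1 : ℂ) ^ (p - 1) * ((p - 1).factorial : ℂ)⁻¹)).comp_tendstoLocallyUniformlyOn h2
  refine (h3.congr fun M s hs => ?_).congr_right fun s hs => ?_
  · simp only [Function.comp_apply, ← taylorCoeff_digammaSum hp hpy M hs, taylorCoeff, smul_eq_mul]
    ring
  · simp only [Function.comp_apply, digammaDeriv, taylorCoeff, smul_eq_mul]
    ring

/-- By the product formula only finitely many coefficients matter. Only one factor varies, as suits
two limits taken one after the other. -/
theorem tendsto_taylorCoeff_mul {A : ℕ → ℂ → ℂ} {f B : ℂ → ℂ} {a : ℂ}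
    (hA : ∀ n, AnalyticAt ℂ (A n) a) (hf : AnalyticAt ℂ f a) (hB : AnalyticAt ℂ B a)
    (h : ∀ j, Tendsto (fun n => taylorCoeff (A n) j a) atTop (𝓝 (taylorCoeff f j a))) (j : ℕ) :
    Tendsto (fun n => taylorCoeff (fun s => A n s * B s) j a) atTop
      (𝓝 (taylorCoeff (fun s => f s * B s) j a)) := by
  simp only [taylorCoeff_mul (hA _) hB, taylorCoeff_mul hf hB]
  exact tendsto_finsetSum _ fun i _ => (h i).mul_const _

/-- The residues of the truncated integrand at a non-integral pole converge to the residue of the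
integrand. -/
theorem exists_tendsto_residue {p : ℕ} (hp : 1 ≤ p) {x y : ℂ} (hx : ‖x‖ = 1) (hy : ‖y‖ = 1)
    (hpy : (p, y) ≠ (1, 1)) {r : RatFunc ℂ} {α : ℂ} (hα : α ∈ poles r)
    (hint : α ∈ integerComplement) :
    ∃ L : ℕ → ℂ, (∀ M : ℕ, Tendsto (fun N : ℕ => residue
        (truncated p x y (Finset.Icc (-N : ℤ) N) (Finset.Icc 0 (M : ℤ)) r) α) atTop (𝓝 (L M))) ∧
      Tendsto L atTop (𝓝 (residue (integrand p x y r) α)) := by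
  have hα' : ∀ n : ℤ, α + n ≠ 0 := fun n => Complex.integerComplement_add_ne_zero hint n
  obtain ⟨hh, hr⟩ := ratVal_clear_pole r α _ rfl
  have hpos : 0 < r.denom.rootMultiplicity α :=
    (Polynomial.rootMultiplicity_pos r.denom_ne_zero).mpr (mem_poles.mp hα)
  obtain ⟨m, hm⟩ := Nat.exists_eq_succ_of_ne_zero hpos.ne'
  rw [hm, Nat.succ_eq_add_one] at hh hr
  set h := ratVal (algebraMap _ _ (Polynomial.X - Polynomial.C α) ^ (m + 1) * r)
  have hΦ := tendstoLocallyUniformlyOn_extTrig hx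
  have hg := tendstoLocallyUniformlyOn_digammaDeriv hp hy hpy
  have hΦan : AnalyticAt ℂ (fun s => extTrig s x) α :=
    (hΦ.differentiableOn (Eventually.of_forall fun _ => differentiableOn_poleSum _ _ _)
      isOpen_integerComplement).analyticAt (isOpen_integerComplement.mem_nhds hint)
  have hgan : AnalyticAt ℂ (digammaDeriv p y) α :=
    (hg.differentiableOn (Eventually.of_forall fun _ => differentiableOn_poleSum _ _ _)
      isOpen_integerComplement).analyticAt (isOpen_integerComplement.mem_nhds hint)
  have hPan : ∀ (p : ℕ) (y : ℂ) (S : Finset ℤ), AnalyticAt ℂ (poleSum p y S) α := fun p y S =>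
    analyticAt_poleSum fun n _ => hα' n
  refine ⟨fun M => taylorCoeff
    (fun s => extTrig s x * (poleSum p y (Finset.Icc 0 (M : ℤ)) s * h s)) m α, fun M => ?_, ?_⟩
  · refine (tendsto_taylorCoeff_mul (fun N => hPan 1 x (Finset.Icc (-N : ℤ) N)) hΦan
      ((hPan p y _).fun_mul hh) (fun j => tendsto_taylorCoeff isOpen_integerComplement
        (fun _ => differentiableOn_poleSum _ _ _) hΦ hint j) m).congr fun N => ?_
    rw [(hasResidue_truncated_ratVal hα' hh hr).residue_eq]
    simp only [mul_assoc]
  · have hres : residue (integrand p x y r) α =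
        taylorCoeff (fun s => digammaDeriv p y s * (extTrig s x * h s)) m α := by
      refine HasResidue.residue_eq ⟨_, m, hgan.fun_mul (hΦan.fun_mul hh), ?_, rfl⟩
      filter_upwards [hr] with s hs
      rw [integrand, hs, digammaDeriv, taylorCoeff]
      generalize (s - α) ^ (m + 1) = d
      ring
    rw [hres]
    refine (tendsto_taylorCoeff_mul (fun M => hPan p y (Finset.Icc 0 (M : ℤ))) hgan
      (hΦan.fun_mul hh) (fun j => tendsto_taylorCoeff isOpen_integerComplement
        (fun _ => differentiableOn_poleSum _ _ _) hg hint j) m).congr fun M => ?_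
    congr 1
    ext s
    ring

/-! ### Passage to the limit -/

theorem summable_const_div_succ_sq (C : ℝ) :
    Summable fun k : ℕ => C * (1 / ((k + 1 : ℕ) : ℝ) ^ 2) :=
  ((summable_nat_add_iff (f := fun n : ℕ => 1 / (n : ℝ) ^ 2) 1).mpr
    (Real.summable_one_div_nat_pow.mpr one_lt_two)).mul_left C

theorem isBigO_ratVal_natCast {r : RatFunc ℂ}
    (hr : ratVal r =O[Bornology.cobounded ℂ] fun s : ℂ => s⁻¹) :
    (fun n : ℕ => ratVal r n) =O[atTop] fun n : ℕ => ((n : ℂ))⁻¹ :=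
  hr.comp_tendsto tendsto_natCast_atTop_cobounded

/-- The terms of the truncated series over the positive integers. -/
theorem exists_norm_positive_term_le {p : ℕ} (hp : 1 ≤ p) {x y : ℂ} (hx : ‖x‖ = 1) (hy : ‖y‖ = 1)
    (hpy : (p, y) ≠ (1, 1)) {r : RatFunc ℂ}
    (hr : ratVal r =O[Bornology.cobounded ℂ] fun s : ℂ => s⁻¹) :
    ∃ C : ℝ, ∀ M k : ℕ, ‖(x ^ (k + 1))⁻¹ * poleSum p y (Finset.Icc 0 (M : ℤ)) ((k + 1 : ℕ) : ℂ) *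
      ratVal r ((k + 1 : ℕ) : ℂ)‖ ≤ C * (1 / ((k + 1 : ℕ) : ℝ) ^ 2) := by
  obtain ⟨C₁, h₁, hC₁⟩ := exists_norm_tail_le hp hy hpy
  obtain ⟨C₂, h₂, hC₂⟩ := exists_norm_le_div (isBigO_ratVal_natCast hr)
  refine ⟨C₁ * C₂, fun M k => ?_⟩
  rw [poleSum_Icc_zero, norm_mul, norm_mul, norm_inv, norm_pow, hx, one_pow, inv_one, one_mul]
  refine (mul_le_mul (hC₁ (k + 1) (by omega) _) (hC₂ (k + 1) (by omega)) (norm_nonneg _)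
    (by positivity)).trans_eq ?_
  field_simp

/-- The two factors of the bound are kept apart: the first comes from the reflected sum, the second
from `r` and gives decay in `M`. -/
theorem exists_norm_negative_term_le {p : ℕ} (hp : 1 ≤ p) {x y : ℂ} (hx : ‖x‖ = 1) (hy : ‖y‖ = 1)
    (hpy : (p, y) ≠ (1, 1)) {r : RatFunc ℂ}
    (hr : ratVal r =O[Bornology.cobounded ℂ] fun s : ℂ => s⁻¹) :
    ∃ C : ℝ, ∀ M k : ℕ, ‖x ^ (k + 1 + M) *
      poleSum p y (Finset.Icc 0 (M : ℤ)) (-((k + 1 + M : ℕ) : ℂ)) *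
      ratVal r (-((k + 1 + M : ℕ) : ℂ))‖ ≤
        C * (1 / ((k + 1 : ℕ) : ℝ)) * (1 / ((k + 1 + M : ℕ) : ℝ)) := by
  have hpy' : (p, y⁻¹) ≠ (1, 1) := fun h => hpy (by
    obtain ⟨h1, h2⟩ := Prod.mk.inj h
    rw [h1, inv_eq_one.mp h2])
  have hy0 : y ≠ 0 := fun h => by simp [h] at hy
  obtain ⟨C₁, h₁, hC₁⟩ := exists_norm_tail_le hp (y := y⁻¹) (by simpa using hy) hpy'
  obtain ⟨C₂, h₂, hC₂⟩ := exists_norm_le_div (isBigO_ratVal_neg hr)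
  refine ⟨C₁ * C₂, fun M k => ?_⟩
  have e1 : ‖((-1 : ℂ) ^ p * y ^ M)‖ = 1 := by simp [hy]
  rw [poleSum_Icc_neg p hy0, norm_mul, norm_mul, norm_pow, hx, one_pow, one_mul, norm_mul, e1,
    one_mul]
  refine (mul_le_mul (hC₁ (k + 1) (by omega) _) (hC₂ (k + 1 + M) (by omega)) (norm_nonneg _)
    (by positivity)).trans_eq ?_
  ring

/-- Dominated convergence in `M`: the tail bound and the decay of `r` dominate the terms by `C / n²`
uniformly in `M`, so `xy ≠ 1` plays no role. -/
theorem tendsto_tsum_positive {p : ℕ} (hp : 1 ≤ p) {x y : ℂ} (hx : ‖x‖ = 1) (hy : ‖y‖ = 1)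
    (hpy : (p, y) ≠ (1, 1)) {r : RatFunc ℂ}
    (hr : ratVal r =O[Bornology.cobounded ℂ] fun s : ℂ => s⁻¹) :
    ∃ (A' : ℕ → ℂ) (A : ℂ),
      (∀ M : ℕ, Tendsto (fun N : ℕ => ∑ n ∈ Finset.Icc 1 N,
        (x ^ n)⁻¹ * poleSum p y (Finset.Icc 0 (M : ℤ)) n * ratVal r n) atTop (𝓝 (A' M))) ∧
      Tendsto A' atTop (𝓝 A) ∧
      SeriesTo (fun n => ((x * y) ^ n)⁻¹ * (polylog p y - zetaFin (n - 1) p y) * ratVal r n) A := by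
  obtain ⟨C, hC⟩ := exists_norm_positive_term_le hp hx hy hpy hr
  have hs := summable_const_div_succ_sq C
  have hlim : ∀ k : ℕ, Tendsto (fun M : ℕ => (x ^ (k + 1))⁻¹ *
      poleSum p y (Finset.Icc 0 (M : ℤ)) ((k + 1 : ℕ) : ℂ) * ratVal r ((k + 1 : ℕ) : ℂ)) atTop
      (𝓝 (((x * y) ^ (k + 1))⁻¹ * (polylog p y - zetaFin (k + 1 - 1) p y) *
        ratVal r ((k + 1 : ℕ) : ℂ))) := by
    intro k
    simp only [poleSum_Icc_zero]
    have := (((tendsto_tail hp hy hpy k).comp (tendsto_add_atTop_nat 1)).const_mul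
      (x ^ (k + 1))⁻¹).mul_const (ratVal r ((k + 1 : ℕ) : ℂ))
    rw [← mul_assoc, ← mul_inv, ← mul_pow] at this
    exact this
  refine ⟨_, _, fun M => ?_, tendsto_tsum_of_dominated_convergence hs hlim
    (Eventually.of_forall hC), ?_⟩
  · exact seriesTo_tsum (u := fun n => (x ^ n)⁻¹ * poleSum p y (Finset.Icc 0 (M : ℤ)) n *
      ratVal r n) (hs.of_norm_bounded (hC M))
  · exact seriesTo_tsum (u := fun n : ℕ => ((x * y) ^ n)⁻¹ * (polylog p y - zetaFin (n - 1) p y) *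
      ratVal r n) (hs.of_norm_bounded fun k => le_of_tendsto (hlim k).norm
        (Eventually.of_forall fun M => hC M k))

theorem sum_Icc_succ_add (u : ℕ → ℂ) (M N : ℕ) :
    ∑ n ∈ Finset.Icc (M + 1) (N + M), u n = ∑ k ∈ Finset.range N, u (k + 1 + M) := by
  induction N with
  | zero => simp
  | succ N ih =>
    rw [show N + 1 + M = (N + M) + 1 by ring, Finset.sum_Icc_succ_top (by omega), ih,
      Finset.sum_range_succ, show N + 1 + M = N + M + 1 by ring]

/-- With `n = k + 1 + M`, the terms are dominated by a multiple of `1 / (k + 1)²` and tend to `0`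
for each fixed `k`, so the contribution from beyond the second cut-off vanishes. -/
theorem tendsto_tsum_negative {p : ℕ} (hp : 1 ≤ p) {x y : ℂ} (hx : ‖x‖ = 1) (hy : ‖y‖ = 1)
    (hpy : (p, y) ≠ (1, 1)) {r : RatFunc ℂ}
    (hr : ratVal r =O[Bornology.cobounded ℂ] fun s : ℂ => s⁻¹) :
    ∃ E : ℕ → ℂ,
      (∀ M : ℕ, Tendsto (fun N => ∑ n ∈ Finset.Icc (M + 1) N,
        x ^ n * poleSum p y (Finset.Icc 0 (M : ℤ)) (-n) * ratVal r (-n)) atTop (𝓝 (E M))) ∧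
      Tendsto E atTop (𝓝 0) := by
  obtain ⟨C, hC⟩ := exists_norm_negative_term_le hp hx hy hpy hr
  have hs := summable_const_div_succ_sq |C|
  have hC' : ∀ M k : ℕ, ‖x ^ (k + 1 + M) *
      poleSum p y (Finset.Icc 0 (M : ℤ)) (-((k + 1 + M : ℕ) : ℂ)) *
      ratVal r (-((k + 1 + M : ℕ) : ℂ))‖ ≤ |C| * (1 / ((k + 1 : ℕ) : ℝ) ^ 2) := by
    intro M k
    have h : 1 / ((k + 1 + M : ℕ) : ℝ) ≤ 1 / ((k + 1 : ℕ) : ℝ) :=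
      one_div_le_one_div_of_le (by positivity) (by exact_mod_cast (by omega))
    calc _ ≤ _ := hC M k
      _ ≤ |C| * (1 / ((k + 1 : ℕ) : ℝ)) * (1 / ((k + 1 : ℕ) : ℝ)) := by
        gcongr; exact le_abs_self C
      _ = _ := by ring
  have hlim : ∀ k : ℕ, Tendsto (fun M : ℕ => x ^ (k + 1 + M) *
      poleSum p y (Finset.Icc 0 (M : ℤ)) (-((k + 1 + M : ℕ) : ℂ)) *
      ratVal r (-((k + 1 + M : ℕ) : ℂ))) atTop (𝓝 0) := by
    intro k
    refine squeeze_zero_norm (fun M => hC M k) ?_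
    have h : Tendsto (fun M : ℕ => 1 / ((k + 1 + M : ℕ) : ℝ)) atTop (𝓝 0) := by
      refine (tendsto_one_div_atTop_nhds_zero_nat (𝕜 := ℝ)).comp ?_
      exact tendsto_atTop_mono (fun M => show M ≤ k + 1 + M by omega) tendsto_id
    simpa using h.const_mul (C * (1 / ((k + 1 : ℕ) : ℝ)))
  have htsum := tendsto_tsum_of_dominated_convergence hs hlim (Eventually.of_forall hC')
  rw [tsum_zero] at htsum
  refine ⟨_, fun M => ?_, htsum⟩
  rw [← tendsto_add_atTop_iff_nat M]
  simp only [sum_Icc_succ_add fun n : ℕ =>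
    x ^ n * poleSum p y (Finset.Icc 0 (M : ℤ)) (-n) * ratVal r (-n)]
  exact (hs.of_norm_bounded (hC' M)).hasSum.tendsto_sum_nat

/-- The two factors add up to `M + 1`, so partial fractions turn the sum into `2 / (M + 1)` times a
harmonic sum, bounded by twice the Cesàro mean of `1 / (k + 1)`. -/
theorem tendsto_sum_one_div_mul :
    Tendsto (fun M : ℕ => ∑ k ∈ Finset.range M, 1 / (((M - k : ℕ) : ℝ) * ((k + 1 : ℕ) : ℝ))) atTop
      (𝓝 0) := by
  have h := (tendsto_one_div_add_atTop_nhds_zero_nat (𝕜 := ℝ)).cesaro.const_mul 2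
  rw [mul_zero] at h
  refine squeeze_zero (fun M => Finset.sum_nonneg fun k _ => by positivity) (fun M => ?_) h
  have e : ∀ k ∈ Finset.range M, 1 / (((M - k : ℕ) : ℝ) * ((k + 1 : ℕ) : ℝ)) =
      1 / ((M : ℝ) + 1) * (1 / (((M - 1 - k : ℕ) : ℝ) + 1) + 1 / ((k : ℝ) + 1)) := by
    intro k hk
    have hk := Finset.mem_range.mp hk
    rw [show ((M - 1 - k : ℕ) : ℝ) + 1 = ((M - k : ℕ) : ℝ) by
      rw [← Nat.cast_add_one]; congr 1; omega]
    have h1 : (0 : ℝ) < ((M - k : ℕ) : ℝ) := by exact_mod_cast (by omega : 0 < M - k)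
    have h2 : (M : ℝ) + 1 = ((M - k : ℕ) : ℝ) + ((k : ℝ) + 1) := by
      rw [Nat.cast_sub hk.le]; ring
    have h3 : (0 : ℝ) < (k : ℝ) + 1 := by positivity
    rw [h2]
    push_cast
    field_simp
    ring
  rw [Finset.sum_congr rfl e, ← Finset.mul_sum, Finset.sum_add_distrib,
    Finset.sum_range_reflect (fun k : ℕ => 1 / ((k : ℝ) + 1)), ← two_mul, ← mul_assoc, mul_comm _ 2,
    mul_assoc]
  rcases Nat.eq_zero_or_pos M with rfl | hM
  · simp
  · have hM' : (0 : ℝ) < M := by exact_mod_cast hM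
    have hS : 0 ≤ ∑ k ∈ Finset.range M, 1 / ((k : ℝ) + 1) :=
      Finset.sum_nonneg fun k _ => by positivity
    rw [one_div ((M : ℝ) + 1)]
    have : ((M : ℝ) + 1)⁻¹ ≤ (M : ℝ)⁻¹ := inv_anti₀ hM' (by linarith)
    gcongr

/-- A tail of size `O(1 / (M - n + 1))` meets `r(-n) = O(1 / n)`. Neither factor is small over the
whole range, but their convolution tends to `0`. -/
theorem tendsto_sum_tail_mul {p : ℕ} (hp : 1 ≤ p) {y z : ℂ} (hy : ‖y‖ = 1) (hz : ‖z‖ = 1)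
    (hpy : (p, y) ≠ (1, 1)) {r : RatFunc ℂ}
    (hr : ratVal r =O[Bornology.cobounded ℂ] fun s : ℂ => s⁻¹) :
    Tendsto (fun M => ∑ n ∈ Finset.Icc 1 M,
      (polylog p y - zetaFin (M - n) p y) * z ^ n * ratVal r (-(n : ℂ))) atTop (𝓝 0) := by
  obtain ⟨C₁, h₁, hC₁⟩ := exists_norm_polylog_sub_le hp hy hpy
  obtain ⟨C₂, h₂, hC₂⟩ := exists_norm_le_div (isBigO_ratVal_neg hr)
  have h := tendsto_sum_one_div_mul.const_mul (C₁ * C₂)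
  rw [mul_zero] at h
  refine squeeze_zero_norm (fun M => ?_) h
  rw [sum_Icc_one, Finset.mul_sum]
  refine (norm_sum_le _ _).trans (Finset.sum_le_sum fun k hk => ?_)
  have hk := Finset.mem_range.mp hk
  rw [norm_mul, norm_mul, norm_pow, hz, one_pow, mul_one]
  have h3 := hC₁ (M - (k + 1))
  rw [show M - (k + 1) + 1 = M - k by omega] at h3
  refine (mul_le_mul h3 (hC₂ (k + 1) (by omega)) (norm_nonneg _) (by positivity)).trans_eq ?_
  rw [div_mul_div_comm, mul_one_div]

theorem tendsto_regCoeff_zero {p : ℕ} (hp : 1 ≤ p) {y : ℂ} (hy : ‖y‖ = 1) (hpy : (p, y) ≠ (1, 1))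
    (k : ℕ) : Tendsto (fun M : ℕ => regCoeff p y (Finset.Icc 0 (M : ℤ)) 0 k) atTop
      (𝓝 (((k + p - 1).choose (p - 1) : ℂ) * (-1) ^ k * polylog (k + p) y)) := by
  have hk : (k + p, y) ≠ (1, 1) := fun h => hpy (by
    obtain ⟨h1, h2⟩ := Prod.mk.inj h
    rw [h2, show p = 1 by omega])
  refine ((tendsto_zetaFin (by omega) hy hk).const_mul _).congr fun M => ?_
  have := regCoeff_Icc_zero p y (Nat.zero_le M) k
  rw [Nat.cast_zero] at this
  rw [this]
  simp [zetaFin]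

theorem residue_truncated_neg {p : ℕ} (hp : 1 ≤ p) {x y : ℂ} (hx : x ≠ 0) (hy : y ≠ 0)
    {r : RatFunc ℂ} (hpoles : ∀ n : ℤ, n ≠ 0 → (n : ℂ) ∉ poles r) {n M N : ℕ} (hn : 1 ≤ n)
    (hnM : n ≤ M) (hMN : M ≤ N) :
    residue (truncated p x y (Finset.Icc (-N : ℤ) N) (Finset.Icc 0 (M : ℤ)) r) (-(n : ℂ)) =
      (x * y) ^ n * localResidue p 0 (regCoeff p y (Finset.Icc 0 (M : ℤ)) n)
        (regCoeff 1 x (Finset.Icc (-N : ℤ) N) n) fun j => taylorCoeff (ratVal r) j (-(n : ℂ)) := by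
  have hr : AnalyticAt ℂ (ratVal r) (-((n : ℤ) : ℂ)) :=
    analyticAt_ratVal (by simpa using hpoles (-n) (by omega))
  have := (hasResidue_truncated_pole hp hx hy (S := Finset.Icc (-N : ℤ) N)
    (T := Finset.Icc 0 (M : ℤ)) (r := r) (n := n) (by simp; omega) (by simp; omega) hr (q := 0)
    (by simp)).residue_eq
  simpa using this

theorem residue_truncated_zero {p : ℕ} (hp : 1 ≤ p) {x y : ℂ} (hx : x ≠ 0) (hy : y ≠ 0)
    {r : RatFunc ℂ} {q : ℕ} (hq : r.denom.rootMultiplicity 0 = q) (M N : ℕ) :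
    residue (truncated p x y (Finset.Icc (-N : ℤ) N) (Finset.Icc 0 (M : ℤ)) r) 0 =
      localResidue p q (regCoeff p y (Finset.Icc 0 (M : ℤ)) 0)
        (regCoeff 1 x (Finset.Icc (-N : ℤ) N) 0)
        fun j => taylorCoeff (ratVal (RatFunc.X ^ q * r)) j 0 := by
  obtain ⟨h1, h2⟩ := ratVal_clear_pole r 0 q hq
  rw [map_zero, sub_zero, RatFunc.algebraMap_X] at h1 h2
  have := (hasResidue_truncated_pole hp hx hy (S := Finset.Icc (-N : ℤ) N)
    (T := Finset.Icc 0 (M : ℤ)) (r := r) (n := 0) (by simp) (by simp)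
    (R := ratVal (RatFunc.X ^ q * r)) (q := q) (by simpa using h1) (by simpa using h2)).residue_eq
  simpa using this

/-- The contributions of the negative integers, after the first truncation is removed. -/
theorem sum_localResidue {p : ℕ} {x y : ℂ} (r : RatFunc ℂ) (M : ℕ) :
    ∑ n ∈ Finset.Icc 1 M, (x * y) ^ n * localResidue p 0 (regCoeff p y (Finset.Icc 0 (M : ℤ)) n)
        (fun k => trigCoeff k x) (fun j => taylorCoeff (ratVal r) j (-(n : ℂ))) =
      ∑ n ∈ Finset.Icc 1 M, (x * y) ^ n * taylorCoeff (ratVal r) p (-(n : ℂ))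
      + ∑ n ∈ Finset.Icc 1 M, ∑ k ∈ Finset.range p,
          trigCoeff k x * ((x * y) ^ n * taylorCoeff (ratVal r) (p - k - 1) (-(n : ℂ)))
      + ∑ n ∈ Finset.Icc 1 M,
          (polylog p y + (-1) ^ p * zetaFin n p y⁻¹) * (x * y) ^ n * ratVal r (-(n : ℂ))
      - ∑ n ∈ Finset.Icc 1 M,
          (polylog p y - zetaFin (M - n) p y) * (x * y) ^ n * ratVal r (-(n : ℂ)) := by
  rw [← Finset.sum_add_distrib, ← Finset.sum_add_distrib, ← Finset.sum_sub_distrib]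
  refine Finset.sum_congr rfl fun n hn => ?_
  have hn := Finset.mem_Icc.mp hn
  have e : ∑ k ∈ Finset.range p,
      trigCoeff k x * ((x * y) ^ n * taylorCoeff (ratVal r) (p - k - 1) (-(n : ℂ))) =
      (x * y) ^ n * ∑ k ∈ Finset.range p,
        trigCoeff k x * taylorCoeff (ratVal r) (p - k - 1) (-(n : ℂ)) := by
    rw [Finset.mul_sum]
    exact Finset.sum_congr rfl fun k _ => by ring
  rw [e]
  simp only [localResidue, add_zero, zero_add, Finset.sum_range_one, Finset.range_zero,
    Finset.sum_empty, Nat.sub_zero, regCoeff_Icc_zero p y hn.2, Nat.choose_self, Nat.cast_one,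
    pow_zero, one_mul]
  simp only [taylorCoeff, iteratedDeriv_zero, Nat.factorial_zero, Nat.cast_one, div_one]
  ring

end CyclotomicEuler

end

open CyclotomicEuler in
theorem mainTheorem11 (x y : ℂ) (hx : IsOfFinOrder x) (hy : IsOfFinOrder y)
    (p : ℕ) (hp : 1 ≤ p) (hpy : (p, y) ≠ (1, 1))
    (r₁ : RatFunc ℂ)
    (hdecay : ratVal r₁ =O[Bornology.cobounded ℂ] (fun s : ℂ => (s ^ 2)⁻¹) ∨
      (x * y ≠ 1 ∧ ratVal r₁ =O[Bornology.cobounded ℂ] (fun s : ℂ => s⁻¹)))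
    (hpoles : ∀ n : ℤ, n ≠ 0 → (n : ℂ) ∉ poles r₁)
    (q : ℕ) (hq : r₁.denom.rootMultiplicity 0 = q)
    (R₁ : ℂ → ℂ) (hR₁ : R₁ = ratVal (RatFunc.X ^ q * r₁)) :
    ∃ A B C D : ℂ,
      SeriesTo (fun n => ((x * y) ^ n)⁻¹ * (polylog p y - zetaFin (n - 1) p y) * ratVal r₁ n) A ∧
      SeriesTo (fun n => (x * y) ^ n * taylorCoeff (ratVal r₁) p (-(n : ℂ))) B ∧
      SeriesTo (fun n => ∑ k ∈ Finset.range p,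
        trigCoeff k x * ((x * y) ^ n * taylorCoeff (ratVal r₁) (p - k - 1) (-(n : ℂ)))) C ∧
      SeriesTo (fun n => (polylog p y + (-1) ^ p * zetaFin n p y⁻¹) * (x * y) ^ n
        * ratVal r₁ (-(n : ℂ))) D ∧
      -∑ α ∈ (poles r₁).erase 0, residue (integrand p x y r₁) α =
        A + B + C + D
        + taylorCoeff R₁ (p + q) 0
        + ∑ k ∈ Finset.range (q + 1), ((k + p - 1).choose (p - 1) : ℂ) * (-1) ^ k
            * polylog (k + p) y * taylorCoeff R₁ (q - k) 0
        + ∑ k ∈ Finset.range (p + q), trigCoeff k x * taylorCoeff R₁ (p + q - k - 1) 0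
        + ∑ k₁ ∈ Finset.range q, ∑ k₂ ∈ Finset.range (q - k₁),
            trigCoeff k₁ x * (((k₂ + p - 1).choose (p - 1) : ℂ) * (-1) ^ k₂ * polylog (k₂ + p) y)
              * taylorCoeff R₁ (q - k₁ - k₂ - 1) 0 := by
  have hx1 : ‖x‖ = 1 := hx.norm_eq_one
  have hy1 : ‖y‖ = 1 := hy.norm_eq_one
  have hx0 : x ≠ 0 := fun h => by simp [h] at hx1
  have hy0 : y ≠ 0 := fun h => by simp [h] at hy1
  have hxy : ‖x * y‖ = 1 := by rw [norm_mul, hx1, hy1, one_mul]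
  have hdec : Decay (x * y) r₁ := hdecay
  have hr := hdec.isBigO
  obtain ⟨A', A, hA'lim, hA', hA⟩ := tendsto_tsum_positive hp hx1 hy1 hpy hr
  obtain ⟨E, hElim, hE⟩ := tendsto_tsum_negative hp hx1 hy1 hpy hr
  obtain ⟨B, hB⟩ := exists_seriesTo_taylorCoeff hxy hdec p
  obtain ⟨C, hC⟩ := exists_seriesTo_trigCoeff hxy hdec p x
  obtain ⟨D, hD⟩ := exists_seriesTo_zetaFin hp hy1 hpy hxy hdec
  refine ⟨A, B, C, D, hA, hB, hC, hD, ?_⟩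
  -- The sequence is asked for at every `α` so that it can be chosen as a function; off the poles it
  -- is a dummy.
  have hL : ∀ α : ℂ, ∃ L : ℕ → ℂ, α ∈ (poles r₁).erase 0 →
      (∀ M : ℕ, Tendsto (fun N : ℕ => residue
        (truncated p x y (Finset.Icc (-N : ℤ) N) (Finset.Icc 0 (M : ℤ)) r₁) α) atTop (𝓝 (L M))) ∧
      Tendsto L atTop (𝓝 (residue (integrand p x y r₁) α)) := by
    intro α
    by_cases hα : α ∈ (poles r₁).erase 0
    · obtain ⟨hα0, hα'⟩ := Finset.mem_erase.mp hα
      obtain ⟨L, hL⟩ := exists_tendsto_residue hp hx1 hy1 hpy hα' (by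
        rintro ⟨n, rfl⟩
        exact hpoles n (by rintro rfl; simp at hα0) hα')
      exact ⟨L, fun _ => hL⟩
    · exact ⟨0, fun h => absurd h hα⟩
  choose L hL using hL
  set T : ℕ → ℂ := fun j => taylorCoeff R₁ j 0 with hT
  -- The limit `N → ∞` with `M` fixed: the residue identity holds for all `N ≥ M`, and each group of
  -- terms converges.
  have hM : ∀ M : ℕ, ∑ α ∈ (poles r₁).erase 0, L α M
      + localResidue p q (regCoeff p y (Finset.Icc 0 (M : ℤ)) 0) (fun k => trigCoeff k x) T
      + ∑ n ∈ Finset.Icc 1 M, (x * y) ^ n *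
          localResidue p 0 (regCoeff p y (Finset.Icc 0 (M : ℤ)) n) (fun k => trigCoeff k x)
            (fun j => taylorCoeff (ratVal r₁) j (-(n : ℂ)))
      + A' M + E M = 0 := by
    intro M
    have h1 := tendsto_finsetSum ((poles r₁).erase 0) fun α hα => (hL α hα).1 M
    have h2 := tendsto_localResidue p q T
      (fun k => tendsto_const_nhds (x := regCoeff p y (Finset.Icc 0 (M : ℤ)) 0 k))
      (fun k => tendsto_regCoeff_one hx1 0 k)
    have h3 := tendsto_finsetSum (Finset.Icc 1 M) fun n _ =>
      (tendsto_localResidue p 0 (fun j => taylorCoeff (ratVal r₁) j (-(n : ℂ)))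
        (fun k => tendsto_const_nhds (x := regCoeff p y (Finset.Icc 0 (M : ℤ)) n k))
        (fun k => tendsto_regCoeff_one hx1 n k)).const_mul ((x * y) ^ n)
    refine tendsto_nhds_unique ((((h1.add h2).add h3).add (hA'lim M)).add (hElim M)) ?_
    refine tendsto_const_nhds.congr' ?_
    filter_upwards [eventually_ge_atTop M] with N hN
    have h4 := sum_residue_truncated hp hx0 hy0 hr hpoles hN
    dsimp only at h4
    rw [residue_truncated_zero hp hx0 hy0 hq, ← hR₁, Finset.sum_congr rfl fun n hn =>
      residue_truncated_neg hp hx0 hy0 hpoles (Finset.mem_Icc.mp hn).1 (Finset.mem_Icc.mp hn).2 hN]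
      at h4
    exact h4.symm
  simp only [sum_localResidue] at hM
  -- The limit `M → ∞`: the partial sums up to `M` become the series `B`, `C`, `D`, while the tail
  -- correction and `E M` vanish.
  have hlim := (((tendsto_finsetSum ((poles r₁).erase 0) fun α hα => (hL α hα).2).add
    (tendsto_localResidue p q T (fun k => tendsto_regCoeff_zero hp hy1 hpy k)
      (fun k => tendsto_const_nhds (x := trigCoeff k x)))).add
    (((hB.add hC).add hD).sub (tendsto_sum_tail_mul hp hy1 hxy hpy hr))).add hA' |>.add hE
  have h0 := tendsto_nhds_unique (hlim.congr hM) tendsto_const_nhds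
  simp only [localResidue, hT] at h0
  linear_combination -h0
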